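/- **Proposition.** Let $\alpha>0$. There are constants $c_\alpha,C_\alpha>0$, depending only on $\alpha$, such that for all integers $d\ge 1$ and $n\ge C_\alpha d^2$ the following holds. Let $H_d$ be the set of real univariate polynomials of degree at most $d$, where $f\in H_d$ gives the point $x$ the label $\operatorname{sign}(f(x))\in\{-1,1\}$, with $\operatorname{sign}(0)=1$. A (randomized, adaptive) learner receives an unlabelled sample $S$ of $n$ real points, may query $\operatorname{sign}(f^{(i)}(x))$ for $x\in S$ and $0\le i\le d$ ($i=0$ being label queries), where $f$ is the hidden polynomial, and finally outputs a labelling of $S$. It is perfect if for every $S$ of $n$ distinct points and every $f\in H_d$ it labels all of $S$ correctly, almost surely over its internal randomness. Let $S$ consist of $n$ independent uniform points of $[0,1]$, and, independently of $S$, let $f$ be a random polynomial of degree $d$ with roots $0\le r_1\le\dots\le r_d\le 1$ (and arbitrary, possibly random, nonzero leading coefficient) whose spacings $(r_1,\,r_2-r_1,\,\dots,\,r_d-r_{d-1},\,1-r_d)$ follow the symmetric Dirichlet distribution $\mathrm{Dir}(\alpha)$ of order $d+1$, i.e. have density $$\frac{\Gamma((d+1)\alpha)}{\Gamma(\alpha)^{d+1}}\prod_{i=1}^{d+1}x_i^{\alpha-1}$$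 on the simplex $x_i\ge 0$, $\sum_i x_i=1$ (with respect to Lebesgue measure in the first $d$ coordinates). Then every perfect learner makes at least $$c_\alpha\, d\log n$$ queries in expectation over $S$, $f$ and its internal randomness (which is independent of $S$ and $f$). -/

import Mathlib

open MeasureTheory Polynomial
open scoped ENNReal

namespace PTFLearning

/-- The class `H_d`: univariate real polynomials of degree at most `d`; the classifier attached
to `f` is `x ↦ sign (f x)`. -/
def hypothesisClass (d : ℕ) : Set ℝ[X] := {f | f.natDegree ≤ d}

/-- The sign of a real number with the convention `sign 0 = +1`; `true` stands for `+1` and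
`false` for `-1`. -/
noncomputable def sgn (t : ℝ) : Bool := decide (0 ≤ t)

/-- The label of the point `x` under the classifier `f`. -/
noncomputable def label (f : ℝ[X]) (x : ℝ) : Bool := sgn (f.eval x)

/-- The answer to the derivative query of order `i` at `x`: the sign of `f⁽ⁱ⁾(x)`. Order `0` is
the label query. -/
noncomputable def derivQuery (f : ℝ[X]) (i : ℕ) (x : ℝ) : Bool := sgn ((derivative^[i] f).eval x)

/-- A deterministic adaptive query strategy on a sample of `n` points: either stop and output
a labelling of the sample, or query the sign of the derivative of order `i ≤ d` at
the `j`-th sample point and continue according to the answer. -/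
inductive QueryTree (n d : ℕ) : Type
  | output (lab : Fin n → Bool) : QueryTree n d
  | query (j : Fin n) (i : Fin (d + 1)) (next : Bool → QueryTree n d) : QueryTree n d

namespace QueryTree

variable {n d : ℕ}

/-- The labelling output by the strategy when run on the sample `S` with hidden hypothesis `f`. -/
noncomputable def result (S : Fin n → ℝ) (f : ℝ[X]) : QueryTree n d → Fin n → Bool
  | output lab => lab
  | query j i next => (next (derivQuery f i (S j))).result S f

/-- The number of queries the strategy makes on the sample `S` with hidden hypothesis `f`. -/
noncomputable def numQueries (S : Fin n → ℝ) (f : ℝ[X]) : QueryTree n d → ℕ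
  | output _ => 0
  | query j i next => (next (derivQuery f i (S j))).numQueries S f + 1

end QueryTree

/-- A randomized learner for samples of `n` points: it sees the unlabelled sample and
a random seed `ω : Ω`, and then runs a deterministic adaptive query strategy. -/
def Learner (n d : ℕ) (Ω : Type*) := (Fin n → ℝ) → Ω → QueryTree n d

/-- The learner is perfect if, for every sample of `n` distinct points and every hypothesis in
`H_d`, it labels the whole sample correctly (with probability one over its seed). -/
def Learner.IsPerfect {n d : ℕ} {Ω : Type*} [MeasurableSpace Ω] (ρ : Measure Ω)
    (A : Learner n d Ω) : Prop :=
  ∀ S : Fin n → ℝ, Function.Injective S → ∀ f ∈ hypothesisClass d,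
    ∀ᵐ ω ∂ρ, ∀ j : Fin n, (A S ω).result S f j = label f (S j)

/-- The law of `n` independent uniformly random points of `[0,1]`. -/
noncomputable def uniformSample (n : ℕ) : Measure (Fin n → ℝ) :=
  Measure.pi fun _ => volume.restrict (Set.Icc (0 : ℝ) 1)

/-- The density of the symmetric Dirichlet distribution of order `m`,
`Γ(mα) / Γ(α)^m * ∏ i, x i ^ (α - 1)` for `x` with nonnegative coordinates, and `0` otherwise. -/
noncomputable def dirichletPDF (m : ℕ) (α : ℝ) (x : Fin m → ℝ) : ℝ :=
  open Classical in
  if ∀ i, 0 ≤ x i then Real.Gamma (m * α) / Real.Gamma α ^ m * ∏ i, x i ^ (α - 1) else 0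

/-- The point `(x_1, …, x_d, 1 - ∑ x_i)` of the hyperplane `∑ y_i = 1` in `ℝ^(d+1)`. -/
def simplexPoint {d : ℕ} (x : Fin d → ℝ) : Fin (d + 1) → ℝ :=
  Fin.snoc (α := fun _ => ℝ) x (1 - ∑ i, x i)

/-- The symmetric Dirichlet distribution `Dir(α)` of order `d + 1`, a law on the standard simplex
in `ℝ^(d+1)`. The density is taken, as usual, with respect to the Lebesgue measure of the first
`d` coordinates, the last one being `1` minus their sum. -/
noncomputable def dirichlet (d : ℕ) (α : ℝ) : Measure (Fin (d + 1) → ℝ) :=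
  ((volume : Measure (Fin d → ℝ)).withDensity
    fun x => ENNReal.ofReal (dirichletPDF (d + 1) α (simplexPoint x))).map simplexPoint

/-- The roots `r_1 ≤ … ≤ r_d` with spacings `x_1, …, x_(d+1)` in `[0,1]`: the root `r_j` is
`x_1 + ⋯ + x_j`. -/
def rootOfSpacings {d : ℕ} (x : Fin (d + 1) → ℝ) (j : Fin d) : ℝ :=
  ∑ i ∈ Finset.Iic j.castSucc, x i

/-- The polynomial with leading coefficient `a` whose roots have spacings `x`. -/
noncomputable def polyOfSpacings {d : ℕ} (a : ℝ) (x : Fin (d + 1) → ℝ) : ℝ[X] :=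
  C a * ∏ j : Fin d, (X - C (rootOfSpacings x j))

/-- `P` is the joint law of the leading coefficient and of the root spacings of a random
polynomial with `d` roots in `[0,1]` whose spacings have law `Dir(α)`. Nothing is imposed on
the leading coefficient beyond being nonzero. -/
structure IsDirichletRootLaw (d : ℕ) (α : ℝ) (P : Measure (ℝ × (Fin (d + 1) → ℝ))) : Prop where
  spacings : P.map Prod.snd = dirichlet d α
  leading : ∀ᵐ p ∂P, p.1 ≠ 0

/-- The expected number of queries of the learner `A` with seed law `ρ`, over an independent
uniform sample, seed, and random polynomial `f` with law given by `P`. As the innermost integrand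
takes finitely many values on measurable sets, no measurability of `A` in the sample or the seed
is needed for a lower bound; for a jointly measurable `A` this is the integral over the product. -/
noncomputable def Learner.expectedQueries {n d : ℕ} {Ω : Type*} [MeasurableSpace Ω]
    (ρ : Measure Ω) (P : Measure (ℝ × (Fin (d + 1) → ℝ))) (A : Learner n d Ω) : ℝ≥0∞ :=
  ∫⁻ S, ∫⁻ ω, ∫⁻ p, ((A S ω).numQueries S (polyOfSpacings p.1 p.2) : ℝ≥0∞)
    ∂P ∂ρ ∂(uniformSample n)

end PTFLearning

namespace PTFLearning

/-! The bound is a counting argument against an anti-concentration estimate. Once sample and seed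
are fixed, the learner is a binary decision tree, so within `q` queries it can output at most `2 ^
q` labellings, whatever the queries mean. A correct output must be the true labelling, so it
suffices that each fixed labelling is correct only with tiny probability over the roots.

In root coordinates the Dirichlet density is a product of powers of consecutive differences. Given
the roots of odd (zero-based) index, those of even index are therefore independent, each with
density proportional to `((t - u) (v - t)) ^ (α - 1)` between its neighbours `u < v`. If the sample
leaves no gap of length `g`, a labelling confines such a root to a set of measure at most `2 * g`,
and by Hölder (`exists_setLIntegral_posPow_le`) this has conditional probability at most `K * (2 * g
/ (v - u)) ^ η`. Integrating out the even roots one at a time (`lintegral_prod_compatibleAt_le`,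
`dirichlet_compatible_le`) gives `δ ^ k` on the event that at least `k` of them have neighbours at
distance of order `1 / d`. Second moments and averaging (`le_dirichlet_manyWide`) show that for some
`k` proportional to `d` this event has probability bounded below.

With probability at least `1 / 2` the sample meets all of about `n ^ (3/4)` equal cells. For `n ≥ d
^ 2` the ratio of `g` to `1 / d` is then `O(n ^ (-1/4))`, so `δ` is at most a negative power of `n`,
and `2 ^ q * δ ^ k` stays small for `q` of order `d * log n` (`two_pow_mul_pow_le`). Randomness of
the learner costs nothing: a sample admits finitely many answer patterns, so almost every seed gives
a tree correct for all hypotheses simultaneously (`Learner.IsPerfect.ae_forall`). -/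

/-! ### Power functions on the half line and the Dirichlet integral -/

/-- The function `t ↦ t ^ (a - 1)` on `[0, ∞)`, extended by zero. -/
noncomputable def posPow (a t : ℝ) : ℝ≥0∞ :=
  if 0 ≤ t then ENNReal.ofReal (t ^ (a - 1)) else 0

lemma posPow_of_nonneg {a t : ℝ} (ht : 0 ≤ t) : posPow a t = ENNReal.ofReal (t ^ (a - 1)) :=
  if_pos ht

lemma posPow_of_neg {a t : ℝ} (ht : t < 0) : posPow a t = 0 := if_neg ht.not_ge

@[fun_prop]
lemma measurable_posPow (a : ℝ) : Measurable (posPow a) :=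
  Measurable.ite measurableSet_Ici (by fun_prop) measurable_const

lemma posPow_mul {a s : ℝ} (hs : 0 < s) (t : ℝ) :
    posPow a (s * t) = ENNReal.ofReal (s ^ (a - 1)) * posPow a t := by
  rcases lt_or_ge t 0 with ht | ht
  · rw [posPow_of_neg ht, posPow_of_neg (mul_neg_of_pos_of_neg hs ht), mul_zero]
  · rw [posPow_of_nonneg ht, posPow_of_nonneg (by positivity), Real.mul_rpow hs.le ht,
      ENNReal.ofReal_mul (by positivity)]

lemma posPow_rpow {a p : ℝ} (hp : 0 < p) (t : ℝ) :
    posPow a t ^ p = posPow (p * (a - 1) + 1) t := by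
  rcases lt_or_ge t 0 with ht | ht
  · rw [posPow_of_neg ht, posPow_of_neg ht, ENNReal.zero_rpow_of_pos hp]
  · rw [posPow_of_nonneg ht, posPow_of_nonneg ht,
      ENNReal.ofReal_rpow_of_nonneg (by positivity) hp.le, ← Real.rpow_mul ht]
    ring_nf

/-- The point `t = 0` is excluded because `0 ^ 0 = 1`: for `a = 0` the two sides would be `0` and
`1`. -/
lemma ofReal_mul_posPow {a t : ℝ} (ht : t ≠ 0) :
    ENNReal.ofReal t * posPow a t = posPow (a + 1) t := by
  rcases ht.lt_or_gt with ht | ht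
  · rw [posPow_of_neg ht, posPow_of_neg ht, mul_zero]
  · rw [posPow_of_nonneg ht.le, posPow_of_nonneg ht.le, ← ENNReal.ofReal_mul ht.le]
    congr 1
    rw [show a + 1 - 1 = 1 + (a - 1) by ring, Real.rpow_add ht, Real.rpow_one]

lemma lintegral_posPow_mul_posPow_one_sub {a b : ℝ} (ha : 0 < a) (hb : 0 < b) :
    ∫⁻ t, posPow a t * posPow b (1 - t) = ENNReal.ofReal (ProbabilityTheory.beta a b) := by
  have hB := ProbabilityTheory.beta_pos ha hb
  have h : ∀ᵐ t : ℝ, posPow a t * posPow b (1 - t) =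
      ENNReal.ofReal (ProbabilityTheory.beta a b) * ProbabilityTheory.betaPDF a b t := by
    filter_upwards [Measure.ae_ne volume (0 : ℝ), Measure.ae_ne volume (1 : ℝ)] with t h0 h1
    rcases h0.lt_or_gt with h0 | h0
    · rw [posPow_of_neg h0, ProbabilityTheory.betaPDF_eq_zero_of_nonpos h0.le, zero_mul, mul_zero]
    rcases h1.lt_or_gt with h1 | h1
    · have h1' : 0 ≤ 1 - t := by linarith
      rw [posPow_of_nonneg h0.le, posPow_of_nonneg h1',
        ProbabilityTheory.betaPDF_of_pos_lt_one h0 h1, ← ENNReal.ofReal_mul (by positivity),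
        ← ENNReal.ofReal_mul (by positivity)]
      congr 1
      field_simp
    · rw [posPow_of_neg (show 1 - t < 0 by linarith),
        ProbabilityTheory.betaPDF_eq_zero_of_one_le h1.le, mul_zero, mul_zero]
  rw [lintegral_congr_ae h, lintegral_const_mul' _ _ ENNReal.ofReal_ne_top,
    ProbabilityTheory.lintegral_betaPDF_eq_one ha hb, mul_one]

lemma lintegral_eq_mul_lintegral_comp_mul {s : ℝ} (hs : 0 < s) {f : ℝ → ℝ≥0∞}
    (hf : Measurable f) : ∫⁻ t, f t = ENNReal.ofReal s * ∫⁻ t, f (s * t) := by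
  conv_lhs => rw [← Real.smul_map_volume_mul_left hs.ne', abs_of_pos hs]
  rw [lintegral_smul_measure, lintegral_map hf (by fun_prop), smul_eq_mul]

/-- The convolution of two power functions on the half line. -/
lemma lintegral_posPow_mul_posPow_sub {a b s : ℝ} (ha : 0 < a) (hb : 0 < b) (hs : s ≠ 0) :
    ∫⁻ t, posPow a t * posPow b (s - t) =
      ENNReal.ofReal (ProbabilityTheory.beta a b) * posPow (a + b) s := by
  -- At `s = 0` the left side vanishes, but for `a + b = 1` the right side would not, again since `0
  -- ^ 0 = 1`. Negative `s` must be kept: it arises as `s - t` in the induction for the Dirichlet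
  -- integral.
  rcases hs.lt_or_gt with hs | hs
  · rw [posPow_of_neg hs, mul_zero, lintegral_eq_zero_iff (by fun_prop)]
    refine Filter.Eventually.of_forall fun t => ?_
    rcases lt_or_ge t 0 with ht | ht
    · simp [posPow_of_neg ht]
    · simp [posPow_of_neg (show s - t < 0 by linarith)]
  · rw [lintegral_eq_mul_lintegral_comp_mul hs (by fun_prop)]
    have h : ∀ t, posPow a (s * t) * posPow b (s - s * t) =
        ENNReal.ofReal (s ^ (a - 1) * s ^ (b - 1)) * (posPow a t * posPow b (1 - t)) := by
      intro t
      rw [show s - s * t = s * (1 - t) by ring, posPow_mul hs, posPow_mul hs,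
        ENNReal.ofReal_mul (by positivity)]
      ring
    simp_rw [h]
    rw [lintegral_const_mul' _ _ ENNReal.ofReal_ne_top,
      lintegral_posPow_mul_posPow_one_sub ha hb, posPow_of_nonneg hs.le, ← mul_assoc,
      ← ENNReal.ofReal_mul hs.le, mul_comm]
    congr 2
    rw [← Real.rpow_add hs]
    conv_lhs => rw [← Real.rpow_one s, ← Real.rpow_mul hs.le, ← Real.rpow_add hs]
    ring_nf

/-- The Dirichlet integral. -/
lemma lintegral_prod_posPow {d : ℕ} (a : Fin d → ℝ) {b : ℝ} (ha : ∀ i, 0 < a i) (hb : 0 < b)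
    {s : ℝ} (hs : s ≠ 0) :
    ∫⁻ x : Fin d → ℝ, (∏ i, posPow (a i) (x i)) * posPow b (s - ∑ i, x i) =
      ENNReal.ofReal ((∏ i, Real.Gamma (a i)) * Real.Gamma b / Real.Gamma (∑ i, a i + b)) *
        posPow (∑ i, a i + b) s := by
  induction d generalizing s with
  | zero =>
    have := Real.Gamma_pos_of_pos hb
    simp [this.ne', Measure.volume_pi_eq_dirac (fun _ : Fin 0 => (0 : ℝ))]
  | succ d ih =>
    rw [← (volume_preserving_piFinSuccAbove (fun _ : Fin (d + 1) => ℝ) 0).symm.lintegral_comp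
      (by fun_prop), Measure.volume_eq_prod, lintegral_prod _ (by fun_prop)]
    have hpos : 0 < ∑ i : Fin d, a i.succ + b :=
      add_pos_of_nonneg_of_pos (Finset.sum_nonneg fun i _ => (ha _).le) hb
    have h : ∀ᵐ t : ℝ, ∫⁻ y : Fin d → ℝ,
        (∏ i, posPow (a i) ((MeasurableEquiv.piFinSuccAbove (fun _ : Fin (d + 1) => ℝ) 0).symm
          (t, y) i)) *
          posPow b (s - ∑ i, (MeasurableEquiv.piFinSuccAbove (fun _ : Fin (d + 1) => ℝ) 0).symm
            (t, y) i) =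
        ENNReal.ofReal ((∏ i : Fin d, Real.Gamma (a i.succ)) * Real.Gamma b /
          Real.Gamma (∑ i : Fin d, a i.succ + b)) *
          (posPow (a 0) t * posPow (∑ i : Fin d, a i.succ + b) (s - t)) := by
      filter_upwards [Measure.ae_ne volume s] with t ht
      have := ih (fun i => a i.succ) (fun i => ha _) (sub_ne_zero.2 ht.symm)
      simp only [MeasurableEquiv.piFinSuccAbove_symm_apply, Fin.insertNthEquiv_apply,
        Fin.insertNth_zero, Fin.prod_univ_succ, Fin.sum_univ_succ, Fin.cons_zero, Fin.cons_succ]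
      calc _ = ∫⁻ y : Fin d → ℝ, posPow (a 0) t * ((∏ i, posPow (a (Fin.succ i)) (y i)) *
            posPow b (s - t - ∑ i, y i)) := by
            refine lintegral_congr fun y => ?_
            rw [mul_assoc, sub_sub]
            rfl
        _ = _ := by
            rw [lintegral_const_mul _ (by fun_prop), this]
            ring
    rw [lintegral_congr_ae h, lintegral_const_mul' _ _ ENNReal.ofReal_ne_top,
      lintegral_posPow_mul_posPow_sub (ha 0) hpos hs, ← mul_assoc, ← ENNReal.ofReal_mul]
    · have h1 := Real.Gamma_pos_of_pos hpos
      rw [ProbabilityTheory.beta]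
      simp only [Fin.prod_univ_succ, Fin.sum_univ_succ, ← add_assoc]
      congr 2
      field_simp
    · have := Real.Gamma_pos_of_pos hpos
      have h2 := Real.Gamma_pos_of_pos hb
      have h3 := Finset.prod_nonneg fun (i : Fin d) (_ : i ∈ Finset.univ) =>
        (Real.Gamma_pos_of_pos (ha i.succ)).le
      positivity

/-! ### Anti-concentration of one root between its neighbours -/

/-- For an interval `(u, v)`, the exponent `η` and the constant `K` below, the law with density
proportional to `((t - u) (v - t)) ^ (α - 1)` gives mass at most `K (vol B / (v - u)) ^ η`
to a set `B`. -/
lemma exists_setLIntegral_posPow_le {α : ℝ} (hα : 0 < α) :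
    ∃ K η : ℝ, 0 < K ∧ 0 < η ∧ ∀ u v : ℝ, u < v → ∀ (B : Set ℝ) (g : ℝ), MeasurableSet B →
      0 ≤ g → volume B ≤ ENNReal.ofReal g →
      ∫⁻ t in B, posPow α (t - u) * posPow α (v - t) ≤
        ENNReal.ofReal (K * (g / (v - u)) ^ η) * ∫⁻ t, posPow α (t - u) * posPow α (v - t) := by
  -- Hölder needs `p > 1` with the `p`-th power of the density still integrable, that is `p * (α -
  -- 1) + 1 > 0`. This choice gives `q = α * (1 + α) / 2`, and `η = α / (2 + α)` is the reciprocal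
  -- of the conjugate exponent.
  set p : ℝ := 1 + α / 2 with hp
  set q : ℝ := p * (α - 1) + 1 with hq
  have hp0 : 0 < p := by positivity
  have hq0 : 0 < q := by rw [hq, hp]; nlinarith [sq_nonneg α]
  have hη : 0 < α / (2 + α) := by positivity
  have hB := ProbabilityTheory.beta_pos hα hα
  have hBq := ProbabilityTheory.beta_pos hq0 hq0
  have hpq : p.HolderConjugate (α / (2 + α))⁻¹ := by
    rw [Real.holderConjugate_iff]
    refine ⟨by linarith, ?_⟩
    rw [hp]
    field_simp
  have key : ∀ a : ℝ, 0 < a → ∀ u v : ℝ, u < v →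
      ∫⁻ t, posPow a (t - u) * posPow a (v - t) =
        ENNReal.ofReal (ProbabilityTheory.beta a a * (v - u) ^ (2 * a - 1)) := by
    intro a ha u v huv
    have := lintegral_posPow_mul_posPow_sub ha ha (sub_pos.2 huv).ne'
    rw [← lintegral_sub_right_eq_self _ u] at this
    simp only [sub_sub_sub_cancel_right] at this
    rw [this, posPow_of_nonneg (sub_pos.2 huv).le,
      ← ENNReal.ofReal_mul (ProbabilityTheory.beta_pos ha ha).le]
    ring_nf
  refine ⟨ProbabilityTheory.beta q q ^ (1 / p) / ProbabilityTheory.beta α α, α / (2 + α),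
    by positivity, hη, fun u v huv B g hBm hg hvol => ?_⟩
  have hL : 0 < v - u := sub_pos.2 huv
  have hH := ENNReal.lintegral_mul_le_Lp_mul_Lq volume hpq
    (f := fun t => posPow α (t - u) * posPow α (v - t)) (g := B.indicator 1)
    (by fun_prop) (measurable_one.indicator hBm).aemeasurable
  have h1 : ∫⁻ t, ((fun t => posPow α (t - u) * posPow α (v - t)) * B.indicator 1 : ℝ → ℝ≥0∞) t =
      ∫⁻ t in B, posPow α (t - u) * posPow α (v - t) := by
    rw [← lintegral_indicator hBm]
    refine lintegral_congr fun t => ?_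
    by_cases h : t ∈ B <;> simp [h]
  have h2 : ∫⁻ t, (B.indicator 1 t : ℝ≥0∞) ^ (α / (2 + α))⁻¹ = volume B := by
    rw [← lintegral_indicator_one hBm]
    refine lintegral_congr fun t => ?_
    by_cases h : t ∈ B
    · simp [h]
    · simp [h, inv_pos.2 hη, -inv_div]
  have h3 : ∫⁻ t, (posPow α (t - u) * posPow α (v - t)) ^ p =
      ENNReal.ofReal (ProbabilityTheory.beta q q * (v - u) ^ (2 * q - 1)) := by
    rw [← key q hq0 u v huv]
    refine lintegral_congr fun t => ?_
    rw [ENNReal.mul_rpow_of_nonneg _ _ hp0.le, posPow_rpow hp0, posPow_rpow hp0]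
  rw [h1, h2, h3] at hH
  refine hH.trans ?_
  rw [key α hα u v huv, one_div (_)⁻¹, inv_inv]
  calc _ ≤ ENNReal.ofReal (ProbabilityTheory.beta q q * (v - u) ^ (2 * q - 1)) ^ (1 / p) *
        ENNReal.ofReal g ^ (α / (2 + α)) := by gcongr
    _ = _ := by
      rw [ENNReal.ofReal_rpow_of_nonneg (by positivity) (by positivity),
        ENNReal.ofReal_rpow_of_nonneg hg hη.le, ← ENNReal.ofReal_mul (by positivity),
        ← ENNReal.ofReal_mul (by positivity)]
      congr 1
      rw [Real.mul_rpow hBq.le (by positivity), ← Real.rpow_mul hL.le, Real.div_rpow hg hL.le]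
      have he : (2 * q - 1) * (1 / p) = (2 * α - 1) - α / (2 + α) := by
        rw [hq, hp]
        field_simp
        ring
      rw [he, Real.rpow_sub hL]
      field_simp

/-! ### Moments of the Dirichlet distribution -/

@[fun_prop]
lemma measurable_simplexPoint {d : ℕ} : Measurable (simplexPoint (d := d)) := by
  rw [measurable_pi_iff]
  intro i
  induction i using Fin.lastCases with
  | last => simp only [simplexPoint, Fin.snoc_last]; fun_prop
  | cast i => simp only [simplexPoint, Fin.snoc_castSucc]; fun_prop

lemma simplexPoint_castSucc {d : ℕ} (x : Fin d → ℝ) (i : Fin d) :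
    simplexPoint x i.castSucc = x i := Fin.snoc_castSucc ..

lemma simplexPoint_last {d : ℕ} (x : Fin d → ℝ) :
    simplexPoint x (Fin.last d) = 1 - ∑ i, x i := Fin.snoc_last ..

/-- The normalizing constant of the symmetric Dirichlet distribution. -/
noncomputable def dirichletConst (m : ℕ) (α : ℝ) : ℝ := Real.Gamma (m * α) / Real.Gamma α ^ m

lemma dirichletConst_pos {m : ℕ} {α : ℝ} (hα : 0 < α) (hm : 0 < m) : 0 < dirichletConst m α := by
  have h1 := Real.Gamma_pos_of_pos hα
  have h2 : 0 < Real.Gamma (m * α) := Real.Gamma_pos_of_pos (by positivity)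
  exact div_pos h2 (by positivity)

lemma ofReal_dirichletPDF {m : ℕ} {α : ℝ} (hα : 0 < α) (hm : 0 < m) (x : Fin m → ℝ) :
    ENNReal.ofReal (dirichletPDF m α x) =
      ENNReal.ofReal (dirichletConst m α) * ∏ i, posPow α (x i) := by
  rw [dirichletPDF]
  split_ifs with h
  · rw [← dirichletConst, ENNReal.ofReal_mul (dirichletConst_pos hα hm).le,
      ENNReal.ofReal_prod_of_nonneg fun i _ => Real.rpow_nonneg (h i) _]
    congr 1
    exact Finset.prod_congr rfl fun i _ => (posPow_of_nonneg (h i)).symm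
  · push Not at h
    obtain ⟨i, hi⟩ := h
    rw [Finset.prod_eq_zero (Finset.mem_univ i) (posPow_of_neg hi)]
    simp

lemma lintegral_dirichlet {d : ℕ} {α : ℝ} (hα : 0 < α) {F : (Fin (d + 1) → ℝ) → ℝ≥0∞}
    (hF : Measurable F) :
    ∫⁻ y, F y ∂(dirichlet d α) = ∫⁻ x : Fin d → ℝ, ENNReal.ofReal (dirichletConst (d + 1) α) *
      (∏ i, posPow α (simplexPoint x i)) * F (simplexPoint x) := by
  rw [dirichlet, lintegral_map hF measurable_simplexPoint]
  simp_rw [ofReal_dirichletPDF hα d.succ_pos]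
  rw [lintegral_withDensity_eq_lintegral_mul _ (by fun_prop) (by fun_prop)]
  rfl

/-- Monomial moments are again Dirichlet integrals, since a monomial only shifts the exponents of
the density. The identity `h` is required only off the coordinate hyperplanes, which are null and
where `ofReal_mul_posPow` can fail. -/
lemma lintegral_dirichlet_prod {d : ℕ} {α : ℝ} (hα : 0 < α) {F : (Fin (d + 1) → ℝ) → ℝ≥0∞}
    (hF : Measurable F) (a : Fin d → ℝ) (ha : ∀ i, 0 < a i)
    (h : ∀ y, (∀ i : Fin d, y i.castSucc ≠ 0) → (∏ i, posPow α (y i)) * F y =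
      (∏ i : Fin d, posPow (a i) (y i.castSucc)) * posPow α (y (Fin.last d))) :
    ∫⁻ y, F y ∂(dirichlet d α) = ENNReal.ofReal (dirichletConst (d + 1) α *
      ((∏ i, Real.Gamma (a i)) * Real.Gamma α / Real.Gamma (∑ i, a i + α))) := by
  rw [lintegral_dirichlet hα hF]
  have hae : ∀ᵐ x : Fin d → ℝ, ∀ i : Fin d, simplexPoint x i.castSucc ≠ 0 := by
    simp_rw [simplexPoint_castSucc]
    exact ae_all_iff.2 fun i => Measure.ae_eval_ne _ i 0
  calc _ = ∫⁻ x : Fin d → ℝ, ENNReal.ofReal (dirichletConst (d + 1) α) *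
        ((∏ i, posPow (a i) (x i)) * posPow α (1 - ∑ i, x i)) := by
        refine lintegral_congr_ae ?_
        filter_upwards [hae] with x hx
        rw [mul_assoc, h _ hx, simplexPoint_last]
        simp_rw [simplexPoint_castSucc]
    _ = _ := by
        rw [lintegral_const_mul' _ _ ENNReal.ofReal_ne_top,
          lintegral_prod_posPow a ha hα one_ne_zero, posPow_of_nonneg zero_le_one,
          ENNReal.ofReal_mul (dirichletConst_pos hα d.succ_pos).le]
        simp

lemma isProbabilityMeasure_dirichlet (d : ℕ) {α : ℝ} (hα : 0 < α) :
    IsProbabilityMeasure (dirichlet d α) := by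
  refine ⟨?_⟩
  rw [← lintegral_one, lintegral_dirichlet_prod hα measurable_const (fun _ => α) (fun _ => hα)]
  · have h1 := Real.Gamma_pos_of_pos hα
    have h2 : 0 < Real.Gamma ((d + 1) * α) := Real.Gamma_pos_of_pos (by positivity)
    rw [← ENNReal.ofReal_one, dirichletConst]
    congr 1
    simp only [Finset.prod_const, Finset.sum_const, Finset.card_univ, Fintype.card_fin,
      nsmul_eq_mul, Nat.cast_add, Nat.cast_one]
    rw [show (d : ℝ) * α + α = (d + 1) * α by ring]
    field_simp
    rw [pow_succ]
  · intro y _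
    simp [Fin.prod_univ_castSucc]

lemma prod_posPow_mul_ofReal {d : ℕ} {α : ℝ} (a : Fin d → ℝ) (i : Fin d)
    {y : Fin (d + 1) → ℝ} (hy : y i.castSucc ≠ 0) :
    (∏ j, posPow (a j) (y j.castSucc)) * posPow α (y (Fin.last d)) * ENNReal.ofReal (y i.castSucc)
      = (∏ j, posPow (a j + if j = i then 1 else 0) (y j.castSucc)) *
        posPow α (y (Fin.last d)) := by
  rw [mul_right_comm]
  congr 1
  rw [← Finset.mul_prod_erase _ _ (Finset.mem_univ i),
    ← Finset.mul_prod_erase (a := i) (f := fun j => posPow (a j + _) _) _ (Finset.mem_univ i),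
    mul_right_comm, mul_comm (posPow _ _), ofReal_mul_posPow hy, if_pos rfl]
  congr 1
  refine Finset.prod_congr rfl fun j hj => ?_
  rw [if_neg (Finset.ne_of_mem_erase hj), add_zero]

lemma lintegral_dirichlet_coord {d : ℕ} {α : ℝ} (hα : 0 < α) (i : Fin d) :
    ∫⁻ y, ENNReal.ofReal (y i.castSucc) ∂(dirichlet d α) = ENNReal.ofReal (1 / (d + 1)) := by
  rw [lintegral_dirichlet_prod hα (by fun_prop) (fun j => α + if j = i then 1 else 0)]
  · have h1 := Real.Gamma_pos_of_pos hα
    have h2 : 0 < Real.Gamma ((d + 1) * α) := Real.Gamma_pos_of_pos (by positivity)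
    have h3 : ∀ j, Real.Gamma (α + if j = i then 1 else 0) =
        Real.Gamma α * if j = i then α else 1 := by
      intro j
      split_ifs
      · rw [Real.Gamma_add_one hα.ne', mul_comm]
      · simp
    have h4 : ∑ j, (α + if j = i then 1 else 0) + α = (d + 1) * α + 1 := by
      simp [Finset.sum_add_distrib]; ring
    rw [dirichletConst, h4, Real.Gamma_add_one (by positivity)]
    simp_rw [h3, Finset.prod_mul_distrib]
    simp only [Finset.prod_const, Finset.card_univ, Fintype.card_fin, Finset.prod_ite_eq',
      Finset.mem_univ, if_true, Nat.cast_add, Nat.cast_one]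
    congr 1
    field_simp
    rw [pow_succ]
  · intro j
    split_ifs <;> linarith
  · intro y hy
    rw [Fin.prod_univ_castSucc, prod_posPow_mul_ofReal _ i (hy i)]

lemma lintegral_dirichlet_coord_sq {d : ℕ} {α : ℝ} (hα : 0 < α) (i : Fin d) :
    ∫⁻ y, ENNReal.ofReal (y i.castSucc) * ENNReal.ofReal (y i.castSucc) ∂(dirichlet d α) =
      ENNReal.ofReal ((α + 1) / ((d + 1) * ((d + 1) * α + 1))) := by
  rw [lintegral_dirichlet_prod hα (by fun_prop)
    -- The exponent shift by two is written as two unit shifts so that `prod_posPow_mul_ofReal`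
    -- applies twice.
    (fun j => α + (if j = i then 1 else 0) + if j = i then 1 else 0)]
  · have h1 := Real.Gamma_pos_of_pos hα
    have h2 : 0 < Real.Gamma ((d + 1) * α) := Real.Gamma_pos_of_pos (by positivity)
    have h3 : ∀ j, Real.Gamma (α + (if j = i then 1 else 0) + if j = i then 1 else 0) =
        Real.Gamma α * if j = i then α * (α + 1) else 1 := by
      intro j
      split_ifs
      · rw [Real.Gamma_add_one (by positivity), Real.Gamma_add_one hα.ne']; ring
      · simp
    have h4 : ∑ j, (α + (if j = i then 1 else 0) + if j = i then 1 else 0) + α =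
        (d + 1) * α + 1 + 1 := by
      simp [Finset.sum_add_distrib]; ring
    rw [dirichletConst, h4, Real.Gamma_add_one (by positivity), Real.Gamma_add_one (by positivity)]
    simp_rw [h3, Finset.prod_mul_distrib]
    simp only [Finset.prod_const, Finset.card_univ, Fintype.card_fin, Finset.prod_ite_eq',
      Finset.mem_univ, if_true, Nat.cast_add, Nat.cast_one]
    congr 1
    field_simp
    rw [pow_succ]
  · intro j
    split_ifs <;> linarith
  · intro y hy
    rw [Fin.prod_univ_castSucc, ← mul_assoc, prod_posPow_mul_ofReal _ i (hy i),
      prod_posPow_mul_ofReal _ i (hy i)]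

/-- Each spacing is at least half its mean with probability bounded below. -/
lemma le_dirichlet_coord_ge {d : ℕ} {α : ℝ} (hα : 0 < α) (i : Fin d) :
    ENNReal.ofReal (α / (4 * (α + 1))) ≤
      dirichlet d α {y | 1 / (2 * ((d : ℝ) + 1)) ≤ y i.castSucc} := by
  have := isProbabilityMeasure_dirichlet d hα
  set μ := dirichlet d α
  set A : Set (Fin (d + 1) → ℝ) := {y | 1 / (2 * ((d : ℝ) + 1)) ≤ y i.castSucc}
  have hA : MeasurableSet A := measurableSet_le measurable_const (by fun_prop)
  -- Chosen so that the quadratic term of `hpt` has expectation at most `1 / (4 * (d + 1))`, a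
  -- quarter of the mean.
  set τ : ℝ := α * (d + 1) / (2 * (α + 1)) with hτ
  have hτ0 : 0 < τ := by positivity
  -- A linear substitute for Paley–Zygmund: on `A` use `y ≤ τ * y ^ 2 / 2 + 1 / (2 * τ)`, off `A`
  -- the threshold itself.
  have hpt : ∀ y : Fin (d + 1) → ℝ, ENNReal.ofReal (y i.castSucc) ≤
      ENNReal.ofReal (1 / (2 * ((d : ℝ) + 1))) +
      ENNReal.ofReal (τ / 2) * (ENNReal.ofReal (y i.castSucc) * ENNReal.ofReal (y i.castSucc)) +
      A.indicator (fun _ => ENNReal.ofReal (1 / (2 * τ))) y := by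
    intro y
    by_cases hy : y ∈ A
    · have hy0 : 0 ≤ y i.castSucc := le_trans (by positivity) hy
      rw [Set.indicator_of_mem hy, ← ENNReal.ofReal_mul hy0, ← ENNReal.ofReal_mul (by positivity),
        ← ENNReal.ofReal_add (by positivity) (by positivity),
        ← ENNReal.ofReal_add (by positivity) (by positivity)]
      refine ENNReal.ofReal_le_ofReal ?_
      have h1 : 0 ≤ 1 / (2 * ((d : ℝ) + 1)) := by positivity
      have h2 : y i.castSucc ≤ τ / 2 * (y i.castSucc * y i.castSucc) + 1 / (2 * τ) := by
        have : τ / 2 * (y i.castSucc * y i.castSucc) + 1 / (2 * τ) - y i.castSucc =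
            (τ * y i.castSucc - 1) ^ 2 / (2 * τ) := by
          field_simp
          ring
        have : 0 ≤ (τ * y i.castSucc - 1) ^ 2 / (2 * τ) := by positivity
        linarith
      linarith
    · have hy' : y i.castSucc < 1 / (2 * ((d : ℝ) + 1)) := not_le.1 hy
      rw [add_assoc]
      exact le_add_right (ENNReal.ofReal_le_ofReal hy'.le)
  have hint := lintegral_mono (μ := μ) hpt
  rw [lintegral_add_right _ (measurable_const.indicator hA), lintegral_add_left measurable_const,
    lintegral_const_mul _ (by fun_prop), lintegral_dirichlet_coord hα,
    lintegral_dirichlet_coord_sq hα, lintegral_indicator_const hA, lintegral_const, measure_univ,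
    mul_one, ← ENNReal.ofReal_mul (by positivity),
    ← ENNReal.ofReal_add (by positivity) (by positivity)] at hint
  rw [← ENNReal.ofReal_toReal (measure_ne_top μ A)] at hint ⊢
  rw [← ENNReal.ofReal_mul (by positivity), ← ENNReal.ofReal_add (by positivity) (by positivity),
    ENNReal.ofReal_le_ofReal_iff (by positivity)] at hint
  refine ENNReal.ofReal_le_ofReal ?_
  set P := (μ A).toReal
  have h1 : τ / 2 * ((α + 1) / (((d : ℝ) + 1) * ((d + 1) * α + 1))) ≤ 1 / (4 * (d + 1)) := by
    rw [hτ]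
    rw [show α * ((d : ℝ) + 1) / (2 * (α + 1)) / 2 * ((α + 1) / ((d + 1) * ((d + 1) * α + 1))) =
      α / (4 * ((d + 1) * α + 1)) by field_simp; ring, div_le_div_iff₀ (by positivity)
        (by positivity)]
    nlinarith
  have h2 : 1 / (4 * ((d : ℝ) + 1)) ≤ 1 / (2 * τ) * P := by
    have : 1 / (2 * ((d : ℝ) + 1)) + 1 / (4 * (d + 1)) + 1 / (4 * (d + 1)) = 1 / (d + 1) := by
      field_simp; norm_num
    linarith
  have h3 : 2 * τ * (1 / (4 * ((d : ℝ) + 1))) ≤ 2 * τ * (1 / (2 * τ) * P) := by gcongr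
  rw [← mul_assoc, mul_one_div_cancel (by positivity), one_mul] at h3
  refine le_trans (le_of_eq ?_) h3
  rw [hτ]
  field_simp

/-! ### From spacings to roots -/

/-- The sequence `0, r_1, …, r_d, 1, 1, …`. -/
def extRoot {d : ℕ} (r : Fin d → ℝ) (k : ℕ) : ℝ :=
  if k = 0 then 0 else if h : k - 1 < d then r ⟨k - 1, h⟩ else 1

lemma extRoot_zero {d : ℕ} (r : Fin d → ℝ) : extRoot r 0 = 0 := if_pos rfl

lemma extRoot_succ {d : ℕ} (r : Fin d → ℝ) (j : Fin d) : extRoot r (j + 1) = r j := by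
  simp [extRoot]

lemma extRoot_of_gt {d : ℕ} (r : Fin d → ℝ) {k : ℕ} (hk : d < k) : extRoot r k = 1 := by
  rw [extRoot, if_neg (by omega), dif_neg (by omega)]

lemma extRoot_update {d : ℕ} (r : Fin d → ℝ) (j : Fin d) (t : ℝ) (k : ℕ) :
    extRoot (Function.update r j t) k = if k = j + 1 then t else extRoot r k := by
  rcases k with _ | k
  · simp [extRoot_zero]
  · by_cases hk : k < d
    · rw [extRoot_succ _ ⟨k, hk⟩, extRoot_succ _ ⟨k, hk⟩, Function.update_apply]
      simp [Fin.ext_iff]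
    · rw [extRoot_of_gt _ (by omega), extRoot_of_gt _ (by omega), if_neg (by omega)]

@[fun_prop]
lemma measurable_extRoot {d : ℕ} (k : ℕ) : Measurable fun r : Fin d → ℝ => extRoot r k := by
  unfold extRoot
  split_ifs <;> fun_prop

lemma sum_filter_lt_succ {m : ℕ} (y : Fin m → ℝ) (i : Fin m) :
    ∑ l with l.val < i.val + 1, y l = ∑ l with l.val < i.val, y l + y i := by
  rw [show (Finset.univ.filter fun l : Fin m => l.val < i.val + 1) =
    insert i (Finset.univ.filter fun l : Fin m => l.val < i.val) by
      ext l; simp [Fin.ext_iff]; omega, Finset.sum_insert (by simp), add_comm]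

lemma extRoot_rootOfSpacings {d : ℕ} {y : Fin (d + 1) → ℝ} (hy : ∑ i, y i = 1) {k : ℕ}
    (hk : k ≤ d + 1) : extRoot (rootOfSpacings y) k = ∑ l with l.val < k, y l := by
  rcases k with _ | k
  · simp [extRoot_zero]
  · by_cases hk' : k < d
    · rw [extRoot_succ _ ⟨k, hk'⟩, rootOfSpacings]
      congr 1
      ext l
      simp [Fin.le_def]
    · rw [extRoot_of_gt _ (by omega), ← hy]
      congr 1
      ext l
      simp
      omega

lemma spacing_eq_sub {d : ℕ} {y : Fin (d + 1) → ℝ} (hy : ∑ i, y i = 1) (i : Fin (d + 1)) :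
    extRoot (rootOfSpacings y) (i + 1) - extRoot (rootOfSpacings y) i = y i := by
  rw [extRoot_rootOfSpacings hy (by omega), extRoot_rootOfSpacings hy (by omega),
    sum_filter_lt_succ, add_sub_cancel_left]

lemma sum_simplexPoint {d : ℕ} (x : Fin d → ℝ) : ∑ i, simplexPoint x i = 1 := by
  simp [Fin.sum_univ_castSucc, simplexPoint_castSucc, simplexPoint_last]

/-- The prefix sum map preserves Lebesgue measure. -/
lemma measurePreserving_rootOfSpacings (d : ℕ) :
    MeasurePreserving fun x : Fin d → ℝ => rootOfSpacings (simplexPoint x) := by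
  set M : Matrix (Fin d) (Fin d) ℝ := Matrix.of fun j i => if i ≤ j then 1 else 0 with hM
  have hdet : M.det = 1 := by
    rw [Matrix.det_of_isLowerTriangular]
    · simp [hM]
    · intro i j hij
      have : i < j := hij
      simp [hM, this]
  have hfun : (fun x : Fin d → ℝ => rootOfSpacings (simplexPoint x)) = Matrix.toLin' M := by
    ext x j
    rw [Matrix.toLin'_apply, Matrix.mulVec, dotProduct, rootOfSpacings,
      show Finset.Iic j.castSucc = Finset.univ.filter (· ≤ j.castSucc) by ext; simp,
      Finset.sum_filter, Fin.sum_univ_castSucc]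
    simp [simplexPoint_castSucc, hM]
  refine ⟨?_, ?_⟩
  · rw [hfun]
    exact (LinearMap.continuous_of_finiteDimensional _).measurable
  · rw [hfun, Real.map_matrix_volume_pi_eq_smul_volume_pi (by rw [hdet]; exact one_ne_zero), hdet]
    simp

@[fun_prop]
lemma measurable_rootOfSpacings {d : ℕ} : Measurable (rootOfSpacings (d := d)) := by
  rw [measurable_pi_iff]
  intro j
  unfold rootOfSpacings
  fun_prop

/-- The unnormalized joint density of the roots. -/
noncomputable def rootDensity {d : ℕ} (α : ℝ) (r : Fin d → ℝ) : ℝ≥0∞ :=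
  ∏ i : Fin (d + 1), posPow α (extRoot r (i + 1) - extRoot r i)

@[fun_prop]
lemma measurable_rootDensity {d : ℕ} (α : ℝ) : Measurable (rootDensity (d := d) α) := by
  unfold rootDensity
  fun_prop

/-- Prefix sums have Jacobian one, so the density carries over unchanged. The integral runs over all
of `ℝ ^ d`; configurations out of order have density zero. -/
lemma lintegral_dirichlet_roots {d : ℕ} {α : ℝ} (hα : 0 < α) {F : (Fin d → ℝ) → ℝ≥0∞}
    (hF : Measurable F) :
    ∫⁻ y, F (rootOfSpacings y) ∂(dirichlet d α) =
      ENNReal.ofReal (dirichletConst (d + 1) α) * ∫⁻ r, F r * rootDensity α r := by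
  rw [lintegral_dirichlet hα (by fun_prop), ← lintegral_const_mul' _ _ ENNReal.ofReal_ne_top]
  conv_rhs => rw [← (measurePreserving_rootOfSpacings d).lintegral_comp (by fun_prop)]
  refine lintegral_congr fun x => ?_
  rw [rootDensity, mul_assoc, mul_comm (∏ i, _)]
  simp_rw [spacing_eq_sub (sum_simplexPoint x)]

lemma ae_dirichlet_sum {d : ℕ} (α : ℝ) : ∀ᵐ y ∂(dirichlet d α), ∑ i, y i = 1 := by
  rw [dirichlet, ae_map_iff (by fun_prop) (measurableSet_eq_fun (by fun_prop) (by fun_prop))]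
  exact Filter.Eventually.of_forall sum_simplexPoint

lemma ae_dirichlet_nonneg {d : ℕ} {α : ℝ} (hα : 0 < α) :
    ∀ᵐ y ∂(dirichlet d α), ∀ i, 0 ≤ y i := by
  rw [ae_all_iff]
  intro i
  have hm : MeasurableSet {y : Fin (d + 1) → ℝ | 0 ≤ y i} :=
    measurableSet_le measurable_const (by fun_prop)
  rw [ae_iff, ← Set.compl_ofPred, ← lintegral_indicator_one hm.compl,
    lintegral_dirichlet hα (measurable_one.indicator hm.compl)]
  refine lintegral_eq_zero_of_ae_eq_zero (Filter.Eventually.of_forall fun x => ?_)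
  by_cases hx : 0 ≤ simplexPoint x i
  · simp [hx]
  · beta_reduce
    rw [Finset.prod_eq_zero (Finset.mem_univ i) (posPow_of_neg (a := α) (not_le.1 hx))]
    simp

lemma monotone_rootOfSpacings {d : ℕ} {y : Fin (d + 1) → ℝ} (hy : ∀ i, 0 ≤ y i) :
    Monotone (rootOfSpacings y) := fun i j hij =>
  Finset.sum_le_sum_of_subset_of_nonneg (Finset.Iic_subset_Iic.2 (by simpa using hij))
    fun l _ _ => hy l

lemma extRoot_rootOfSpacings_mem {d : ℕ} {y : Fin (d + 1) → ℝ} (hs : ∑ i, y i = 1)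
    (hy : ∀ i, 0 ≤ y i) {k : ℕ} (hk : k ≤ d + 1) :
    extRoot (rootOfSpacings y) k ∈ Set.Icc (0 : ℝ) 1 := by
  rw [extRoot_rootOfSpacings hs hk]
  refine ⟨Finset.sum_nonneg fun l _ => hy l, ?_⟩
  rw [← hs]
  exact Finset.sum_le_sum_of_subset_of_nonneg (Finset.filter_subset _ _) fun l _ _ => hy l

/-- A root enters only the two factors of its adjacent spacings. This is the source of the
conditional independence of nonadjacent roots. -/
lemma rootDensity_update {d : ℕ} (α : ℝ) (r : Fin d → ℝ) (j : Fin d) (t : ℝ) :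
    rootDensity α (Function.update r j t) =
      (posPow α (t - extRoot r j) * posPow α (extRoot r (j + 2) - t)) *
        ∏ i ∈ (Finset.univ.erase j.castSucc).erase j.succ,
          posPow α (extRoot r (i + 1) - extRoot r i) := by
  have hj : j.succ ∈ Finset.univ.erase j.castSucc := by
    simp [Fin.ext_iff]
  rw [rootDensity, ← Finset.mul_prod_erase _ _ (Finset.mem_univ j.castSucc),
    ← Finset.mul_prod_erase _ _ hj, ← mul_assoc]
  simp only [extRoot_update, Fin.val_castSucc, Fin.val_succ]
  rw [if_pos trivial, if_neg (by omega), if_neg (by omega)]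
  congr 1
  refine Finset.prod_congr rfl fun i hi => ?_
  simp only [Finset.mem_erase, ne_eq, Fin.ext_iff, Fin.val_castSucc, Fin.val_succ, Finset.mem_univ,
    and_true] at hi
  rw [if_neg (by omega), if_neg (by omega)]

/-! ### Positions of a root compatible with a labelling -/

/-- The positions `t` of a root in `(u, v)` that are compatible with the labelling `lab` of the
sample points in `(u, v)`: the label changes at `t` and nowhere else. -/
def compatible {n : ℕ} (S : Fin n → ℝ) (lab : Fin n → Bool) (u v t : ℝ) : Prop :=
  ∃ σ : Bool, ∀ s, u < S s → S s < v → S s ≠ t → (lab s = σ ↔ S s < t)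

lemma measurable_compatible {n : ℕ} {X : Type*} [MeasurableSpace X] (S : Fin n → ℝ)
    (lab : Fin n → Bool) {u v t : X → ℝ} (hu : Measurable u) (hv : Measurable v)
    (ht : Measurable t) : MeasurableSet {x | compatible S lab (u x) (v x) (t x)} := by
  refine measurableSet_setOfPred.2 (Measurable.exists fun σ => Measurable.forall fun s => ?_)
  refine .imp (measurableSet_setOfPred.1 (measurableSet_lt hu measurable_const)) <|
    .imp (measurableSet_setOfPred.1 (measurableSet_lt measurable_const hv)) <|
    .imp (measurableSet_setOfPred.1 (measurableSet_eq_fun measurable_const ht)).not <|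
    .iff measurable_const (measurableSet_setOfPred.1 (measurableSet_lt measurable_const ht))

/-- Every subinterval of `[0, 1]` of length at least `g` contains a sample point. -/
def GapBound {n : ℕ} (S : Fin n → ℝ) (g : ℝ) : Prop :=
  ∀ a b : ℝ, 0 ≤ a → b ≤ 1 → a + g ≤ b → ∃ s, a < S s ∧ S s < b

/-- For a fixed label `σ` to the left of the root, two admissible positions more than `g` apart
would have a sample point between them, on which they demand opposite labels. So each `σ`
contributes diameter at most `g`, and there are two of them. -/
lemma volume_compatible_le {n : ℕ} {S : Fin n → ℝ} {g : ℝ} (hg : 0 ≤ g) (hS : GapBound S g)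
    (lab : Fin n → Bool) {u v : ℝ} (hu : 0 ≤ u) (hv : v ≤ 1) :
    volume ({t | compatible S lab u v t} ∩ Set.Icc u v) ≤ ENNReal.ofReal (2 * g) := by
  set B : Bool → Set ℝ := fun σ =>
    {t | ∀ s, u < S s → S s < v → S s ≠ t → (lab s = σ ↔ S s < t)} ∩ Set.Icc u v with hB
  have hvol : ∀ σ, volume (B σ) ≤ ENNReal.ofReal g := by
    intro σ
    refine (Real.volume_le_diam _).trans (Metric.ediam_le fun t ht t' ht' => ?_)
    wlog htt : t ≤ t' generalizing t t'
    · rw [edist_comm]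
      exact this t' ht' t ht (le_of_not_ge htt)
    rw [edist_dist, Real.dist_eq, abs_sub_comm, abs_of_nonneg (sub_nonneg.2 htt)]
    refine ENNReal.ofReal_le_ofReal ?_
    by_contra! hlt
    obtain ⟨s, hs, hs'⟩ := hS t t' (hu.trans ht.2.1) (ht'.2.2.trans hv) (by linarith)
    have h1 := ht.1 s (ht.2.1.trans_lt hs) (hs'.trans_le ht'.2.2) hs.ne'
    have h2 := ht'.1 s (ht.2.1.trans_lt hs) (hs'.trans_le ht'.2.2) hs'.ne
    exact absurd (h1.1 (h2.2 hs')) hs.not_gt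
  have hsub : {t | compatible S lab u v t} ∩ Set.Icc u v ⊆ B true ∪ B false := by
    rintro t ⟨⟨σ, hσ⟩, ht⟩
    cases σ
    · exact Or.inr ⟨hσ, ht⟩
    · exact Or.inl ⟨hσ, ht⟩
  calc _ ≤ volume (B true) + volume (B false) := (measure_mono hsub).trans (measure_union_le _ _)
    _ ≤ ENNReal.ofReal g + ENNReal.ofReal g := add_le_add (hvol _) (hvol _)
    _ = _ := by rw [← ENNReal.ofReal_add hg hg, two_mul]

/-- The one-dimensional estimate in the form used for a single root. -/
def OneRootBound (α g l : ℝ) (δ : ℝ≥0∞) : Prop :=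
  ∀ u v : ℝ, l ≤ v - u → ∀ B : Set ℝ, MeasurableSet B → volume B ≤ ENNReal.ofReal (2 * g) →
    ∫⁻ t in B, posPow α (t - u) * posPow α (v - t) ≤
      δ * ∫⁻ t, posPow α (t - u) * posPow α (v - t)

/-- The Hölder bound decreases in the distance of the neighbours, so a lower bound `l` on it can be
used instead. -/
lemma exists_oneRootBound {α : ℝ} (hα : 0 < α) :
    ∃ K η : ℝ, 0 < K ∧ 0 < η ∧ ∀ g l : ℝ, 0 ≤ g → 0 < l →
      OneRootBound α g l (ENNReal.ofReal (K * (2 * g / l) ^ η)) := by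
  obtain ⟨K, η, hK, hη, h⟩ := exists_setLIntegral_posPow_le hα
  refine ⟨K, η, hK, hη, fun g l hg hl u v huv B hB hvol => ?_⟩
  refine (h u v (by linarith) B (2 * g) hB (by positivity) hvol).trans ?_
  have : 0 ≤ 2 * g / (v - u) := div_nonneg (by positivity) (hl.le.trans huv)
  gcongr

/-! ### Integrating out the roots of even index -/

/-- The neighbours of the root `r_j` lie in `[0, 1]`, at distance at least `l`. -/
def IsWide {d : ℕ} (l : ℝ) (r : Fin d → ℝ) (j : Fin d) : Prop :=
  0 ≤ extRoot r j ∧ extRoot r (j + 2) ≤ 1 ∧ l ≤ extRoot r (j + 2) - extRoot r j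

lemma measurableSet_isWide {d : ℕ} (l : ℝ) (j : Fin d) :
    MeasurableSet {r : Fin d → ℝ | IsWide l r j} :=
  have h := fun k => measurable_extRoot (d := d) k
  (measurableSet_le measurable_const (h j)).inter
    ((measurableSet_le (h (j + 2)) measurable_const).inter
      (measurableSet_le measurable_const ((h (j + 2)).sub (h j))))

/-- The neighbours of an even index are odd indices or the endpoints `0` and `1`, so moving an even
root leaves them fixed. -/
lemma isWide_update {d : ℕ} (l : ℝ) {i j : Fin d} (hi : Even i.val) (hj : Even j.val)
    (r : Fin d → ℝ) (t : ℝ) : IsWide l (Function.update r j t) i ↔ IsWide l r i := by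
  obtain ⟨a, ha⟩ := hi
  obtain ⟨b, hb⟩ := hj
  simp only [IsWide, extRoot_update]
  rw [if_neg (by omega), if_neg (by omega)]

open Classical in
/-- The factor gained at the root `r_j`. -/
noncomputable def gain {d : ℕ} (l : ℝ) (δ : ℝ≥0∞) (j : Fin d) (r : Fin d → ℝ) : ℝ≥0∞ :=
  if IsWide l r j then δ else 1

@[fun_prop]
lemma measurable_gain {d : ℕ} (l : ℝ) (δ : ℝ≥0∞) (j : Fin d) : Measurable (gain l δ j) := by
  classical
  exact Measurable.ite (measurableSet_isWide l j) measurable_const measurable_const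

/-- The root configurations whose `j`-th root is compatible with the labelling. -/
def compatibleAt {n d : ℕ} (S : Fin n → ℝ) (lab : Fin n → Bool) (j : Fin d) :
    Set (Fin d → ℝ) :=
  {r | compatible S lab (extRoot r j) (extRoot r (j + 2)) (r j)}

lemma measurableSet_compatibleAt {n d : ℕ} (S : Fin n → ℝ) (lab : Fin n → Bool) (j : Fin d) :
    MeasurableSet (compatibleAt S lab j) :=
  measurable_compatible S lab (by fun_prop) (by fun_prop) (by fun_prop)

/-- The density vanishes outside `[u, v]`, so the compatible set may be cut down to the part whose
volume is controlled. -/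
lemma lintegral_compatible_le {n : ℕ} {S : Fin n → ℝ} {α g l : ℝ} {δ : ℝ≥0∞} (hg : 0 ≤ g)
    (hS : GapBound S g) (hδ : OneRootBound α g l δ) (lab : Fin n → Bool) {u v : ℝ} (hu : 0 ≤ u)
    (hv : v ≤ 1) (huv : l ≤ v - u) :
    ∫⁻ t, {t | compatible S lab u v t}.indicator 1 t * (posPow α (t - u) * posPow α (v - t)) ≤
      δ * ∫⁻ t, posPow α (t - u) * posPow α (v - t) := by
  have hm : MeasurableSet ({t | compatible S lab u v t} ∩ Set.Icc u v) :=
    (measurable_compatible S lab measurable_const measurable_const measurable_id).inter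
      measurableSet_Icc
  refine le_trans (le_of_eq ?_) (hδ u v huv _ hm (volume_compatible_le hg hS lab hu hv))
  rw [← lintegral_indicator hm]
  refine lintegral_congr fun t => ?_
  by_cases ht : t ∈ Set.Icc u v
  · by_cases hc : compatible S lab u v t <;> simp [hc, ht, Set.indicator]
  · rw [Set.indicator_of_notMem (s := _ ∩ _) fun h => ht h.2]
    rw [Set.mem_Icc, not_and_or, not_le, not_le] at ht
    rcases ht with ht | ht
    · rw [posPow_of_neg (show t - u < 0 by linarith), zero_mul, mul_zero]
    · rw [posPow_of_neg (show v - t < 0 by linarith), mul_zero, mul_zero]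

lemma gain_update {d : ℕ} (l : ℝ) (δ : ℝ≥0∞) {i j : Fin d} (hi : Even i.val) (hj : Even j.val)
    (r : Fin d → ℝ) (t : ℝ) : gain l δ i (Function.update r j t) = gain l δ i r := by
  by_cases h : IsWide l r i <;> simp [gain, isWide_update l hi hj, h]

lemma update_mem_compatibleAt {n d : ℕ} (S : Fin n → ℝ) (lab : Fin n → Bool) {i j : Fin d}
    (hij : i ≠ j) (hi : Even i.val) (hj : Even j.val) (r : Fin d → ℝ) (t : ℝ) :
    Function.update r j t ∈ compatibleAt S lab i ↔ r ∈ compatibleAt S lab i := by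
  obtain ⟨a, ha⟩ := hi
  obtain ⟨b, hb⟩ := hj
  simp only [compatibleAt, Set.mem_ofPred_eq, extRoot_update]
  rw [if_neg (by omega), if_neg (by omega), Function.update_of_ne hij]

/-- Integrating out one root. -/
lemma lintegral_compatibleAt_mul_le {n d : ℕ} {S : Fin n → ℝ} {α g l : ℝ} {δ : ℝ≥0∞} (hg : 0 ≤ g)
    (hS : GapBound S g) (hδ : OneRootBound α g l δ) (lab : Fin n → Bool) {j : Fin d}
    (hj : Even j.val) {G : (Fin d → ℝ) → ℝ≥0∞} (hG : Measurable G)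
    (hGj : ∀ r t, G (Function.update r j t) = G r) :
    ∫⁻ r, (compatibleAt S lab j).indicator 1 r * (G r * rootDensity α r) ≤
      ∫⁻ r, gain l δ j r * (G r * rootDensity α r) := by
  have hm1 : Measurable fun r => (compatibleAt S lab j).indicator (1 : (Fin d → ℝ) → ℝ≥0∞) r *
      (G r * rootDensity α r) :=
    (measurable_one.indicator (measurableSet_compatibleAt S lab j)).mul
      (hG.mul (measurable_rootDensity α))
  rw [volume_pi]
  refine lintegral_le_of_lmarginal_le {j} hm1 (by fun_prop) fun r => ?_
  simp only [lmarginal_singleton, hGj, gain_update l δ hj hj, rootDensity_update]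
  set R := ∏ i ∈ (Finset.univ.erase j.castSucc).erase j.succ,
    posPow α (extRoot r (i + 1) - extRoot r i)
  set u := extRoot r j
  set v := extRoot r (j + 2)
  have hind : ∀ t, (compatibleAt S lab j).indicator (1 : (Fin d → ℝ) → ℝ≥0∞)
      (Function.update r j t) = {t | compatible S lab u v t}.indicator 1 t := by
    intro t
    have : Function.update r j t ∈ compatibleAt S lab j ↔ compatible S lab u v t := by
      simp [compatibleAt, extRoot_update, u, v]
    by_cases h : compatible S lab u v t <;> simp [Set.indicator, this, h]
  calc _ = (∫⁻ t, {t | compatible S lab u v t}.indicator 1 t *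
        (posPow α (t - u) * posPow α (v - t))) * (G r * R) := by
        have hm : Measurable fun t : ℝ => {t | compatible S lab u v t}.indicator
            (1 : ℝ → ℝ≥0∞) t * (posPow α (t - u) * posPow α (v - t)) :=
          (measurable_one.indicator (measurable_compatible S lab measurable_const
            measurable_const measurable_id)).mul (by fun_prop)
        rw [← lintegral_mul_const _ hm]
        refine lintegral_congr fun t => ?_
        rw [hind]
        ring
    _ ≤ (gain l δ j r * ∫⁻ t, posPow α (t - u) * posPow α (v - t)) * (G r * R) := by
        gcongr
        rw [gain]
        split_ifs with h
        · exact lintegral_compatible_le hg hS hδ lab h.1 h.2.1 h.2.2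
        · rw [one_mul]
          refine lintegral_mono fun t => ?_
          refine mul_le_of_le_one_left zero_le ?_
          exact Set.indicator_le_self' (by simp) t
    _ = _ := by
        rw [← lintegral_const_mul _ (by fun_prop), ← lintegral_mul_const _ (by fun_prop)]
        refine lintegral_congr fun t => ?_
        ring

/-- Integrating out a set of pairwise nonadjacent roots. -/
lemma lintegral_prod_compatibleAt_le {n d : ℕ} {S : Fin n → ℝ} {α g l : ℝ} {δ : ℝ≥0∞}
    (hg : 0 ≤ g) (hS : GapBound S g) (hδ : OneRootBound α g l δ) (lab : Fin n → Bool)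
    (O : Finset (Fin d)) (hO : ∀ j ∈ O, Even j.val) {G : (Fin d → ℝ) → ℝ≥0∞} (hG : Measurable G)
    (hGO : ∀ j : Fin d, Even j.val → ∀ r t, G (Function.update r j t) = G r) :
    ∫⁻ r, (∏ j ∈ O, (compatibleAt S lab j).indicator 1 r) * (G r * rootDensity α r) ≤
      ∫⁻ r, (∏ j ∈ O, gain l δ j r) * (G r * rootDensity α r) := by
  have hind : ∀ j : Fin d, Measurable ((compatibleAt S lab j).indicator
      (1 : (Fin d → ℝ) → ℝ≥0∞)) := fun j =>
    measurable_one.indicator (measurableSet_compatibleAt S lab j)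
  induction O using Finset.induction_on generalizing G with
  | empty => simp
  | insert i O hi ih =>
    have hiE := hO i (Finset.mem_insert_self i O)
    have hO' : ∀ j ∈ O, Even j.val := fun j hj => hO j (Finset.mem_insert_of_mem hj)
    simp_rw [Finset.prod_insert hi]
    calc _ = ∫⁻ r, (compatibleAt S lab i).indicator 1 r *
          ((∏ j ∈ O, (compatibleAt S lab j).indicator 1 r) * G r * rootDensity α r) := by
          refine lintegral_congr fun r => ?_
          ring
      -- The remaining indicators do not involve the root `i`, since their indices are even and
      -- differ from `i`; they join `G` as a constant factor.
      _ ≤ ∫⁻ r, gain l δ i r *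
          ((∏ j ∈ O, (compatibleAt S lab j).indicator 1 r) * G r * rootDensity α r) := by
          refine lintegral_compatibleAt_mul_le hg hS hδ lab hiE
            ((Finset.measurable_prod _ fun j _ => hind j).mul hG) fun r t => ?_
          rw [hGO i hiE]
          congr 1
          refine Finset.prod_congr rfl fun j hj => ?_
          have := update_mem_compatibleAt S lab (ne_of_mem_of_not_mem hj hi) (hO' j hj) hiE r t
          by_cases h : r ∈ compatibleAt S lab j <;> simp [Set.indicator, this, h]
      -- The gain depends on odd roots only, so it can be absorbed into `G` for the induction
      -- hypothesis; this is why `G` is general.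
      _ = ∫⁻ r, (∏ j ∈ O, (compatibleAt S lab j).indicator 1 r) *
          (gain l δ i r * G r * rootDensity α r) := by
          refine lintegral_congr fun r => ?_
          ring
      _ ≤ ∫⁻ r, (∏ j ∈ O, gain l δ j r) * (gain l δ i r * G r * rootDensity α r) := by
          refine ih hO' (by fun_prop) fun j hj r t => ?_
          rw [hGO j hj, gain_update l δ hiE hj]
      _ = _ := by
          refine lintegral_congr fun r => ?_
          ring

/-- The indices `j` for which `j` is even; no two of the corresponding roots are adjacent. -/
def evenIndices (d : ℕ) : Finset (Fin d) := Finset.univ.filter fun j => Even j.val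

open Classical in
/-- The root configurations with at least `k` wide indices among the even ones. -/
def manyWide (d : ℕ) (l : ℝ) (k : ℕ) : Set (Fin d → ℝ) :=
  {r | k ≤ ((evenIndices d).filter fun j => IsWide l r j).card}

lemma measurableSet_manyWide (d : ℕ) (l : ℝ) (k : ℕ) : MeasurableSet (manyWide d l k) := by
  classical
  have : Measurable fun r : Fin d → ℝ => ((evenIndices d).filter fun j => IsWide l r j).card := by
    simp_rw [Finset.card_filter]
    exact Finset.measurable_sum _ fun j _ =>
      Measurable.ite (measurableSet_isWide l j) measurable_const measurable_const
  exact this measurableSet_Ici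

lemma update_mem_manyWide {d : ℕ} (l : ℝ) (k : ℕ) {j : Fin d} (hj : Even j.val) (r : Fin d → ℝ)
    (t : ℝ) : Function.update r j t ∈ manyWide d l k ↔ r ∈ manyWide d l k := by
  rw [manyWide, Set.mem_ofPred_eq, Set.mem_ofPred_eq]
  classical
  have h : ∀ i ∈ evenIndices d, IsWide l (Function.update r j t) i ↔ IsWide l r i :=
    fun i hi => isWide_update l (Finset.mem_filter.1 hi).2 hj r t
  rw [Finset.filter_congr h]

/-- A fixed labelling is unlikely when many indices are wide. -/
lemma dirichlet_compatible_le {n d : ℕ} {S : Fin n → ℝ} {α g l : ℝ} {δ : ℝ≥0∞} (hα : 0 < α)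
    (hg : 0 ≤ g) (hS : GapBound S g) (hδ : OneRootBound α g l δ) (hδ1 : δ ≤ 1)
    (lab : Fin n → Bool) (k : ℕ) :
    dirichlet d α {y | rootOfSpacings y ∈ manyWide d l k ∧
      ∀ j ∈ evenIndices d, rootOfSpacings y ∈ compatibleAt S lab j} ≤ δ ^ k := by
  classical
  have := isProbabilityMeasure_dirichlet d hα
  have hW := measurableSet_manyWide d l k
  have hO : ∀ j ∈ evenIndices d, Even j.val := fun j hj => (Finset.mem_filter.1 hj).2
  set E : Set (Fin d → ℝ) :=
    manyWide d l k ∩ ⋂ j ∈ evenIndices d, compatibleAt S lab j with hE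
  have hEm : MeasurableSet E := hW.inter
    (Finset.measurableSet_biInter _ fun j _ => measurableSet_compatibleAt S lab j)
  have hset : {y | rootOfSpacings y ∈ manyWide d l k ∧
      ∀ j ∈ evenIndices d, rootOfSpacings y ∈ compatibleAt S lab j} =
      (rootOfSpacings (d := d)) ⁻¹' E := by
    ext y
    simp [hE]
  -- Indices that are not wide contribute `1`; at least `k` contribute `δ ≤ 1`.
  have hgain : ∀ r ∈ manyWide d l k, ∏ j ∈ evenIndices d, gain l δ j r ≤ δ ^ k := by
    intro r hr
    simp only [gain]
    rw [Finset.prod_ite, Finset.prod_const, Finset.prod_const_one, mul_one]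
    exact pow_le_pow_right_of_le_one' hδ1 hr
  rw [hset, ← lintegral_indicator_one (measurable_rootOfSpacings hEm)]
  calc _ = ∫⁻ y, E.indicator 1 (rootOfSpacings y) ∂(dirichlet d α) := rfl
    _ = ENNReal.ofReal (dirichletConst (d + 1) α) * ∫⁻ r,
        (∏ j ∈ evenIndices d, (compatibleAt S lab j).indicator 1 r) *
          ((manyWide d l k).indicator 1 r * rootDensity α r) := by
        rw [lintegral_dirichlet_roots hα (measurable_one.indicator hEm)]
        congr 1
        refine lintegral_congr fun r => ?_
        by_cases hr : r ∈ manyWide d l k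
        · by_cases hc : ∀ j ∈ evenIndices d, r ∈ compatibleAt S lab j
          · rw [Finset.prod_eq_one fun j hj => by simp [hc j hj],
              Set.indicator_of_mem (show r ∈ E from ⟨hr, by simpa using hc⟩),
              Set.indicator_of_mem hr]
            simp
          · push Not at hc
            obtain ⟨j, hj, hjr⟩ := hc
            rw [Finset.prod_eq_zero hj (by simp [hjr]), Set.indicator_of_notMem]
            · simp
            · intro h
              exact hjr (by simpa using Set.mem_iInter₂.1 h.2 j hj)
        · rw [Set.indicator_of_notMem hr, Set.indicator_of_notMem fun h => hr h.1]
          simp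
    _ ≤ ENNReal.ofReal (dirichletConst (d + 1) α) * ∫⁻ r,
        (∏ j ∈ evenIndices d, gain l δ j r) *
          ((manyWide d l k).indicator 1 r * rootDensity α r) := by
        gcongr _ * ?_
        refine lintegral_prod_compatibleAt_le hg hS hδ lab _ hO (measurable_one.indicator hW)
          fun j hj r t => ?_
        by_cases h : r ∈ manyWide d l k <;>
          simp [Set.indicator, update_mem_manyWide l k hj, h]
    _ ≤ ENNReal.ofReal (dirichletConst (d + 1) α) * ∫⁻ r, δ ^ k * rootDensity α r := by
        gcongr _ * ?_
        refine lintegral_mono fun r => ?_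
        by_cases hr : r ∈ manyWide d l k
        · rw [Set.indicator_of_mem hr, Pi.one_apply, one_mul]
          gcongr
          exact hgain r hr
        · simp [hr]
    -- The change of variables is read backwards to recover total mass one.
    _ = ∫⁻ _, δ ^ k ∂(dirichlet d α) :=
        (lintegral_dirichlet_roots hα (F := fun _ => δ ^ k) measurable_const).symm
    _ = δ ^ k := by simp

/-! ### Labellings of actual polynomials, and many wide indices -/

lemma le_extRoot {d : ℕ} {r : Fin d → ℝ} (hr : Monotone r) {i : Fin d} {k : ℕ} (hk : i.val < k)
    (hkd : k ≤ d) : r i ≤ extRoot r k := by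
  obtain ⟨k, rfl⟩ : ∃ k', k = k' + 1 := ⟨k - 1, by omega⟩
  rw [extRoot_succ r ⟨k, by omega⟩]
  exact hr (Fin.le_def.2 (by simp; omega))

lemma extRoot_le {d : ℕ} {r : Fin d → ℝ} (hr : Monotone r) {i : Fin d} {k : ℕ} (hk : k ≤ i.val) :
    extRoot r (k + 1) ≤ r i := by
  rw [extRoot_succ r ⟨k, by omega⟩]
  exact hr (Fin.le_def.2 hk)

/-- The labelling of the sample by a polynomial is compatible with each of its roots. -/
lemma rootOfSpacings_mem_compatibleAt {n d : ℕ} (S : Fin n → ℝ) {a : ℝ} (ha : a ≠ 0)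
    {y : Fin (d + 1) → ℝ} (hy : ∀ i, 0 ≤ y i) (j : Fin d) :
    rootOfSpacings y ∈ compatibleAt S (fun s => label (polyOfSpacings a y) (S s)) j := by
  set r := rootOfSpacings y with hr
  have hmono : Monotone r := monotone_rootOfSpacings hy
  set u := extRoot r j with hu
  set v := extRoot r (j + 2) with hv
  set h : ℝ → ℝ := fun x => a * ∏ i ∈ Finset.univ.erase j, (x - r i) with hh
  have heval : ∀ x, (polyOfSpacings a y).eval x = (x - r j) * h x := by
    intro x
    rw [polyOfSpacings, eval_mul, eval_C, eval_prod, hh,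
      ← Finset.mul_prod_erase _ _ (Finset.mem_univ j)]
    simp only [eval_sub, eval_X, eval_C, ← hr]
    ring
  -- The cofactor `h` has no zero in `(u, v)`, since all other roots are at most `u` or at least
  -- `v`.
  have hsign : ∀ x x', u < x → x < v → u < x' → x' < v → 0 < h x * h x' := by
    intro x x' hx1 hx2 hx1' hx2'
    have : h x * h x' = a ^ 2 * ∏ i ∈ Finset.univ.erase j, ((x - r i) * (x' - r i)) := by
      rw [Finset.prod_mul_distrib]
      ring
    rw [this]
    refine mul_pos (by positivity) (Finset.prod_pos fun i hi => ?_)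
    rcases lt_or_gt_of_ne (Finset.ne_of_mem_erase hi) with hij | hij
    · have : r i ≤ u := le_extRoot hmono hij j.2.le
      exact mul_pos (by linarith) (by linarith)
    · have : v ≤ r i := extRoot_le hmono hij
      exact mul_pos_of_neg_of_neg (by linarith) (by linarith)
  -- To the left of the root the factor `x - r j` is negative, so the label there is `true` exactly
  -- when the cofactor is negative.
  refine ⟨decide (h ((u + v) / 2) < 0), fun s hus hsv hne => ?_⟩
  have hs := hsign (S s) ((u + v) / 2) hus hsv (by linarith) (by linarith)
  simp only [label, sgn, heval, decide_eq_decide] at hs ⊢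
  rcases lt_or_ge (h ((u + v) / 2)) 0 with hc | hc
  · have hneg : h (S s) < 0 := by nlinarith
    simp only [hc, iff_true]
    constructor
    · intro h0
      exact lt_of_le_of_ne (by nlinarith) hne
    · intro hlt
      exact (mul_pos_of_neg_of_neg (by linarith) hneg).le
  · have hpos : 0 < h (S s) := by nlinarith
    simp only [hc.not_gt, iff_false, not_le]
    constructor
    · intro h0
      nlinarith
    · intro hlt
      exact mul_neg_of_neg_of_pos (by linarith) hpos

/-- The map `j ↦ j - 1` injects the odd indices into the even ones. -/
lemma card_evenIndices (d : ℕ) : d ≤ 2 * (evenIndices d).card := by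
  have h1 := Finset.card_filter_add_card_filter_not (s := (Finset.univ : Finset (Fin d)))
    (fun j => Even j.val)
  have h2 : (Finset.univ.filter fun j : Fin d => ¬ Even j.val).card ≤ (evenIndices d).card := by
    refine Finset.card_le_card_of_injOn (fun j => ⟨j.val - 1, by omega⟩) ?_ ?_
    · intro j hj
      simp only [Finset.coe_filter, Finset.mem_univ, true_and, Set.mem_ofPred_eq,
        Nat.not_even_iff_odd] at hj
      simp only [evenIndices, Finset.coe_filter, Finset.mem_univ, true_and, Set.mem_ofPred_eq]
      exact Nat.Odd.sub_odd hj odd_one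
    · intro i hi j hj hij
      simp only [Finset.coe_filter, Finset.mem_univ, true_and, Set.mem_ofPred_eq,
        Nat.not_even_iff_odd] at hi hj
      have := hi.pos
      have := hj.pos
      simp only [Fin.mk.injEq] at hij
      exact Fin.ext (by omega)
  rw [Finset.card_univ, Fintype.card_fin] at h1
  rw [evenIndices] at *
  omega

lemma isWide_of_le {d : ℕ} {y : Fin (d + 1) → ℝ} (hs : ∑ i, y i = 1) (hy : ∀ i, 0 ≤ y i)
    {l : ℝ} {j : Fin d} (hl : l ≤ y j.castSucc) : IsWide l (rootOfSpacings y) j := by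
  refine ⟨(extRoot_rootOfSpacings_mem hs hy (by omega)).1,
    (extRoot_rootOfSpacings_mem hs hy (by omega)).2, ?_⟩
  have h1 := spacing_eq_sub hs j.castSucc
  have h2 := spacing_eq_sub hs j.succ
  have h3 := hy j.succ
  simp only [Fin.val_castSucc, Fin.val_succ, add_assoc, one_add_one_eq_two] at h1 h2
  linarith

/-- With probability bounded below, a positive fraction of the even indices is wide. -/
lemma le_dirichlet_manyWide {d : ℕ} {α : ℝ} (hα : 0 < α) (hd : 1 ≤ d) :
    ENNReal.ofReal (α / (4 * (α + 1)) / 2) ≤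
      dirichlet d α {y | rootOfSpacings y ∈ manyWide d (1 / (2 * ((d : ℝ) + 1)))
        ⌈α / (4 * (α + 1)) / 2 * (evenIndices d).card⌉₊} := by
  classical
  have := isProbabilityMeasure_dirichlet d hα
  set c := α / (4 * (α + 1)) with hc
  have hc0 : 0 < c := by positivity
  set m := (evenIndices d).card with hm
  have hm0 : (0 : ℝ) < m := by
    have := card_evenIndices d
    exact_mod_cast (show 0 < m by omega)
  set l := 1 / (2 * ((d : ℝ) + 1)) with hl
  set k := ⌈c / 2 * m⌉₊ with hk
  set W := {y | rootOfSpacings y ∈ manyWide d l k} with hW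
  have hWm : MeasurableSet W := measurable_rootOfSpacings (measurableSet_manyWide d l k)
  set A : Fin d → Set (Fin (d + 1) → ℝ) := fun j => {y | l ≤ y j.castSucc} with hA
  have hAm : ∀ j, MeasurableSet (A j) := fun j => measurableSet_le measurable_const (by fun_prop)
  -- Reverse Markov: the number of long spacings has mean at least `c * m` and is at most `m`, and
  -- off `W` it is at most `c * m / 2`.
  have hpt : ∀ᵐ y ∂(dirichlet d α), ∑ j ∈ evenIndices d, (A j).indicator (1 : (Fin (d + 1) → ℝ) → ℝ≥0∞) y ≤
      W.indicator (fun _ => (m : ℝ≥0∞)) y + ENNReal.ofReal (c / 2 * m) := by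
    filter_upwards [ae_dirichlet_sum α, ae_dirichlet_nonneg hα] with y hs hy
    have hsum : ∑ j ∈ evenIndices d, (A j).indicator (1 : (Fin (d + 1) → ℝ) → ℝ≥0∞) y =
        ((evenIndices d).filter fun j => y ∈ A j).card := by
      rw [Finset.card_filter]
      push_cast
      exact Finset.sum_congr rfl fun j _ => by simp [Set.indicator]
    rw [hsum]
    by_cases hyW : y ∈ W
    · rw [Set.indicator_of_mem hyW]
      refine le_add_right ?_
      exact_mod_cast Finset.card_filter_le _ _
    · refine le_add_left ?_
      have hlt : ((evenIndices d).filter fun j => y ∈ A j).card < k := by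
        refine lt_of_le_of_lt (Finset.card_le_card ?_) (not_le.1 hyW)
        intro j hj
        rw [Finset.mem_filter] at hj ⊢
        exact ⟨hj.1, isWide_of_le hs hy hj.2⟩
      rw [← ENNReal.ofReal_natCast]
      exact ENNReal.ofReal_le_ofReal (Nat.lt_ceil.1 hlt).le
  have hint := lintegral_mono_ae hpt
  rw [lintegral_finsetSum _ fun j _ => measurable_one.indicator (hAm j),
    lintegral_add_right _ measurable_const, lintegral_indicator_const hWm, lintegral_const,
    measure_univ, mul_one] at hint
  simp_rw [lintegral_indicator_one (hAm _)] at hint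
  have hlow : ENNReal.ofReal (m * c) ≤ ∑ j ∈ evenIndices d, dirichlet d α (A j) := by
    calc ENNReal.ofReal (m * c) = ∑ j ∈ evenIndices d, ENNReal.ofReal c := by
          rw [Finset.sum_const, nsmul_eq_mul, ENNReal.ofReal_mul (by positivity),
            ENNReal.ofReal_natCast]
      _ ≤ _ := Finset.sum_le_sum fun j _ => le_dirichlet_coord_ge hα j
  have h := hlow.trans hint
  rw [← ENNReal.ofReal_toReal (measure_ne_top (dirichlet d α) W)] at h ⊢
  rw [← ENNReal.ofReal_natCast, ← ENNReal.ofReal_mul (by positivity),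
    ← ENNReal.ofReal_add (by positivity) (by positivity),
    ENNReal.ofReal_le_ofReal_iff (by positivity)] at h
  refine ENNReal.ofReal_le_ofReal ?_
  nlinarith

/-! ### Counting the outputs of a query strategy -/

namespace QueryTree

variable {n d : ℕ}

/-- The labellings that the strategy can output after at most `k` queries. -/
def reachable : QueryTree n d → ℕ → Finset (Fin n → Bool)
  | output lab, _ => {lab}
  | query _ _ _, 0 => ∅
  | query _ _ next, k + 1 => (next true).reachable k ∪ (next false).reachable k

lemma card_reachable_le (T : QueryTree n d) (k : ℕ) : (T.reachable k).card ≤ 2 ^ k := by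
  induction T generalizing k with
  | output lab => simp [reachable, Nat.one_le_two_pow]
  | query j i next ih =>
    cases k with
    | zero => simp [reachable]
    | succ k =>
      rw [reachable, pow_succ, mul_two]
      exact (Finset.card_union_le _ _).trans (add_le_add (ih _ _) (ih _ _))

lemma result_mem_reachable (S : Fin n → ℝ) (f : ℝ[X]) (T : QueryTree n d) {k : ℕ}
    (hk : T.numQueries S f ≤ k) : T.result S f ∈ T.reachable k := by
  induction T generalizing k with
  | output lab => simp [reachable, result]
  | query j i next ih =>
    cases k with
    | zero => simp [numQueries] at hk
    | succ k =>
      rw [numQueries, Nat.add_le_add_iff_right] at hk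
      have := ih _ hk
      rw [reachable, result, Finset.mem_union]
      cases h : derivQuery f i (S j) <;> rw [h] at this
      · exact Or.inr this
      · exact Or.inl this

/-- The outcome of a strategy depends only on the answers to the derivative queries. -/
lemma result_congr {S : Fin n → ℝ} {f f' : ℝ[X]} (T : QueryTree n d)
    (h : ∀ (j : Fin n) (i : Fin (d + 1)), derivQuery f i (S j) = derivQuery f' i (S j)) :
    T.result S f = T.result S f' := by
  induction T with
  | output lab => rfl
  | query j i next ih =>
    rw [result, result, h]
    exact ih _

end QueryTree

lemma polyOfSpacings_mem_hypothesisClass {d : ℕ} (a : ℝ) (y : Fin (d + 1) → ℝ) :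
    polyOfSpacings a y ∈ hypothesisClass d := by
  refine (natDegree_C_mul_le _ _).trans ((natDegree_prod_le _ _).trans ?_)
  simp

/-- The expected number of queries of a deterministic strategy that is correct on the sample. -/
lemma le_lintegral_numQueries {n d : ℕ} {α g : ℝ} {δ : ℝ≥0∞} (hα : 0 < α) (hd : 1 ≤ d)
    (hg : 0 ≤ g) {S : Fin n → ℝ} (hS : GapBound S g)
    (hδ : OneRootBound α g (1 / (2 * ((d : ℝ) + 1))) δ) (hδ1 : δ ≤ 1)
    {P : Measure (ℝ × (Fin (d + 1) → ℝ))} (hP : IsDirichletRootLaw d α P) (T : QueryTree n d)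
    (hT : ∀ f ∈ hypothesisClass d, ∀ j, T.result S f j = label f (S j)) (q : ℕ)
    (hq : 2 ^ q * δ ^ ⌈α / (4 * (α + 1)) / 2 * (evenIndices d).card⌉₊ ≤
      ENNReal.ofReal (α / (4 * (α + 1)) / 4)) :
    ENNReal.ofReal (q * (α / (4 * (α + 1)) / 4)) ≤
      ∫⁻ p, (T.numQueries S (polyOfSpacings p.1 p.2) : ℝ≥0∞) ∂P := by
  classical
  set c := α / (4 * (α + 1)) with hc
  have hc0 : 0 < c := by positivity
  set l := 1 / (2 * ((d : ℝ) + 1)) with hl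
  set k := ⌈c / 2 * (evenIndices d).card⌉₊ with hk
  set μ := dirichlet d α with hμ
  have := isProbabilityMeasure_dirichlet d hα
  set W := {y : Fin (d + 1) → ℝ | rootOfSpacings y ∈ manyWide d l k} with hW
  set V : (Fin n → Bool) → Set (Fin (d + 1) → ℝ) := fun lab =>
    {y | rootOfSpacings y ∈ manyWide d l k ∧
      ∀ j ∈ evenIndices d, rootOfSpacings y ∈ compatibleAt S lab j} with hV
  have hWm : MeasurableSet W := measurable_rootOfSpacings (measurableSet_manyWide d l k)
  have hVm : ∀ lab, MeasurableSet (V lab) := by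
    intro lab
    have : V lab = W ∩ ⋂ j ∈ evenIndices d,
        (rootOfSpacings (d := d)) ⁻¹' compatibleAt S lab j := by
      ext y
      simp [hV, hW]
    rw [this]
    exact hWm.inter (Finset.measurableSet_biInter _ fun j _ =>
      measurable_rootOfSpacings (measurableSet_compatibleAt S lab j))
  -- On `U` the true labelling is out of reach within `q` queries, up to null sets. The union
  -- removes mass at most `c / 4` from `W`, which has at least `c / 2`.
  set U := W \ ⋃ lab ∈ T.reachable q, V lab with hU
  have hUm : MeasurableSet U := hWm.diff (Finset.measurableSet_biUnion _ fun lab _ => hVm lab)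
  have hμU : ENNReal.ofReal (c / 4) ≤ μ U := by
    have h1 : μ W ≤ μ U + ENNReal.ofReal (c / 4) := by
      calc μ W ≤ μ (U ∪ ⋃ lab ∈ T.reachable q, V lab) := measure_mono (by
            rw [hU, Set.sdiff_union_self]
            exact Set.subset_union_left)
        _ ≤ μ U + ∑ lab ∈ T.reachable q, μ (V lab) :=
            (measure_union_le _ _).trans (by gcongr; exact measure_biUnion_finset_le _ _)
        _ ≤ μ U + ∑ lab ∈ T.reachable q, δ ^ k := by
            gcongr with lab
            exact dirichlet_compatible_le hα hg hS hδ hδ1 lab k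
        _ ≤ μ U + 2 ^ q * δ ^ k := by
            rw [Finset.sum_const, nsmul_eq_mul]
            gcongr
            exact_mod_cast T.card_reachable_le q
        _ ≤ _ := by gcongr
    have h2 := (le_dirichlet_manyWide hα hd).trans h1
    rw [show c / 2 = c / 4 + c / 4 by ring, ENNReal.ofReal_add (by positivity) (by positivity)]
      at h2
    exact (ENNReal.add_le_add_iff_right ENNReal.ofReal_ne_top).1 h2
  have hPU : P (Prod.snd ⁻¹' U) = μ U := by
    rw [hμ, ← hP.spacings, Measure.map_apply measurable_snd hUm]
  have hnonneg : ∀ᵐ p ∂P, ∀ i, 0 ≤ p.2 i := by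
    have := ae_dirichlet_nonneg (d := d) hα
    rw [← hP.spacings] at this
    exact ae_of_ae_map measurable_snd.aemeasurable this
  calc ENNReal.ofReal (q * (c / 4)) ≤ q * P (Prod.snd ⁻¹' U) := by
        rw [ENNReal.ofReal_mul (by positivity), ENNReal.ofReal_natCast, hPU]
        gcongr
    _ = ∫⁻ p, (Prod.snd ⁻¹' U).indicator (fun _ => (q : ℝ≥0∞)) p ∂P :=
        (lintegral_indicator_const (measurable_snd hUm) _).symm
    _ ≤ _ := by
        refine lintegral_mono_ae ?_
        filter_upwards [hnonneg, hP.leading] with p hp ha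
        by_cases hpU : p.2 ∈ U
        · rw [Set.indicator_of_mem (show p ∈ Prod.snd ⁻¹' U from hpU)]
          by_contra! hlt
          have hle : T.numQueries S (polyOfSpacings p.1 p.2) ≤ q := by exact_mod_cast hlt.le
          have hres := T.result_mem_reachable S _ hle
          have hlab : T.result S (polyOfSpacings p.1 p.2) =
              fun s => label (polyOfSpacings p.1 p.2) (S s) :=
            funext fun s => hT _ (polyOfSpacings_mem_hypothesisClass _ _) s
          refine hpU.2 (Set.mem_biUnion hres ⟨hpU.1, fun j _ => ?_⟩)
          rw [hlab]
          exact rootOfSpacings_mem_compatibleAt S ha hp j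
        · rw [Set.indicator_of_notMem (show p ∉ Prod.snd ⁻¹' U from hpU)]
          exact zero_le

/-- Almost surely over its seed, a perfect learner is correct for all hypotheses at once, since
only finitely many answer patterns are possible on a given sample. -/
lemma Learner.IsPerfect.ae_forall {n d : ℕ} {Ω : Type*} [MeasurableSpace Ω] {ρ : Measure Ω}
    {A : Learner n d Ω} (hA : A.IsPerfect ρ) {S : Fin n → ℝ} (hS : Function.Injective S) :
    ∀ᵐ ω ∂ρ, ∀ f ∈ hypothesisClass d, ∀ j, (A S ω).result S f j = label f (S j) := by
  let pattern : ℝ[X] → Fin n → Fin (d + 1) → Bool := fun f j i => derivQuery f i (S j)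
  have h : ∀ π : Fin n → Fin (d + 1) → Bool, ∀ᵐ ω ∂ρ,
      ∀ f ∈ hypothesisClass d, pattern f = π → ∀ j, (A S ω).result S f j = label f (S j) := by
    intro π
    by_cases hπ : ∃ f ∈ hypothesisClass d, pattern f = π
    · obtain ⟨f, hf, hfπ⟩ := hπ
      filter_upwards [hA S hS f hf] with ω hω f' _ hf' j
      have heq : ∀ j i, derivQuery f' (i : Fin (d + 1)) (S j) = derivQuery f i (S j) :=
        fun j i => congrFun (congrFun (hf'.trans hfπ.symm) j) i
      rw [(A S ω).result_congr heq, hω j]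
      -- Queries of order `0` are label queries, so the answer pattern determines the labels too.
      exact (heq j 0).symm
    · exact Filter.Eventually.of_forall fun ω f hf hfπ => absurd ⟨f, hf, hfπ⟩ hπ
  filter_upwards [ae_all_iff.2 h] with ω hω f hf j
  exact hω _ f hf rfl j

/-! ### Gaps of a uniform sample -/

instance isProbabilityMeasure_uniformSample (n : ℕ) :
    IsProbabilityMeasure (uniformSample n) := by
  have : IsProbabilityMeasure (volume.restrict (Set.Icc (0 : ℝ) 1)) := ⟨by simp⟩
  unfold uniformSample
  infer_instance

/-- Almost every sample consists of distinct points. -/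
lemma ae_uniformSample_injective (n : ℕ) :
    ∀ᵐ S ∂(uniformSample n), Function.Injective S := by
  have h : ∀ i j : Fin n, ∀ᵐ S ∂(uniformSample n), S i = S j → i = j := by
    intro i j
    by_cases hij : i = j
    · exact Filter.Eventually.of_forall fun _ _ => hij
    have hac : uniformSample n ≪ volume := by
      rw [uniformSample, ← Measure.restrict_pi_pi]
      exact Measure.absolutelyContinuous_of_le Measure.restrict_le_self
    refine hac.ae_le ?_
    let p : Submodule ℝ (Fin n → ℝ) :=
      LinearMap.ker (LinearMap.proj (R := ℝ) (φ := fun _ : Fin n => ℝ) i - LinearMap.proj j)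
    have hp : p ≠ ⊤ := by
      intro htop
      have : Pi.single i (1 : ℝ) ∈ p := htop ▸ Submodule.mem_top
      simp [p, Ne.symm hij] at this
    have hzero := Measure.addHaar_submodule volume p hp
    refine measure_mono_null (fun S hS => ?_) hzero
    simp only [Set.mem_compl_iff, Set.mem_ofPred_eq, Classical.not_imp] at hS
    simp [p, hS.1]
  filter_upwards [ae_all_iff.2 fun i => ae_all_iff.2 (h i)] with S hS i j hij
  exact hS i j hij

/-- The samples that hit each of the `K` cells of the regular partition of `[0, 1]`. -/
def hitsCells (n K : ℕ) : Set (Fin n → ℝ) :=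
  {S | ∀ i : Fin K, ∃ s, S s ∈ Set.Ioo ((i : ℝ) / K) ((i + 1) / K)}

/-- An interval of length `2 / K` contains a whole cell, namely the one with index `⌈a * K⌉₊`. -/
lemma gapBound_of_mem_hitsCells {n K : ℕ} (hK : 0 < K) {S : Fin n → ℝ} (hS : S ∈ hitsCells n K) :
    GapBound S (2 / K) := by
  intro a b ha hb hab
  have hK' : (0 : ℝ) < K := by exact_mod_cast hK
  set i := ⌈a * K⌉₊ with hi
  have h1 : a * K ≤ i := Nat.le_ceil _
  have h2 : (i : ℝ) < a * K + 1 := Nat.ceil_lt_add_one (by positivity)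
  have h3 : a * K + 2 ≤ b * K := by
    have := mul_le_mul_of_nonneg_right hab hK'.le
    rwa [add_mul, div_mul_cancel₀ _ hK'.ne'] at this
  have h4 : b * K ≤ K := mul_le_of_le_one_left hK'.le hb
  have hiK : i < K := by
    have : (i : ℝ) < K := by linarith
    exact_mod_cast this
  obtain ⟨s, hs1, hs2⟩ := hS ⟨i, hiK⟩
  refine ⟨s, lt_of_le_of_lt ?_ hs1, hs2.trans_le ?_⟩
  · rw [le_div_iff₀ hK']
    exact h1
  · rw [div_le_iff₀ hK']
    simp only
    linarith

lemma measurableSet_hitsCells (n K : ℕ) : MeasurableSet (hitsCells n K) := by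
  have : hitsCells n K = ⋂ i : Fin K, ⋃ s : Fin n,
      (fun S : Fin n → ℝ => S s) ⁻¹' Set.Ioo ((i : ℝ) / K) ((i + 1) / K) := by
    ext S
    simp [hitsCells]
  rw [this]
  exact .iInter fun i => .iUnion fun s => measurable_pi_apply s measurableSet_Ioo

/-- Union bound over the cells: all `n` independent points miss a given one with probability `(1 - 1
/ K) ^ n`. -/
lemma uniformSample_compl_hitsCells_le (n K : ℕ) (hK : 0 < K) :
    uniformSample n (hitsCells n K)ᶜ ≤ ENNReal.ofReal (K * (1 - 1 / K) ^ n) := by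
  have hK' : (0 : ℝ) < K := by exact_mod_cast hK
  have hK1 : (1 : ℝ) ≤ K := by exact_mod_cast hK
  have h0 : 0 ≤ 1 - 1 / (K : ℝ) := sub_nonneg.2 ((div_le_one hK').2 hK1)
  have hcell : ∀ i : Fin K, volume.restrict (Set.Icc (0 : ℝ) 1)
      (Set.Ioo ((i : ℝ) / K) ((i + 1) / K))ᶜ = ENNReal.ofReal (1 - 1 / K) := by
    intro i
    have hi : ((i : ℝ) + 1) ≤ K := by exact_mod_cast i.2
    have hsub : Set.Ioo ((i : ℝ) / K) ((i + 1) / K) ⊆ Set.Icc 0 1 := by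
      intro t ht
      refine ⟨le_trans (by positivity) ht.1.le, ht.2.le.trans ?_⟩
      rwa [div_le_one hK']
    rw [Measure.restrict_apply measurableSet_Ioo.compl, Set.inter_comm, ← Set.sdiff_eq,
      measure_sdiff hsub measurableSet_Ioo.nullMeasurableSet (by simp), Real.volume_Icc,
      Real.volume_Ioo, ← ENNReal.ofReal_sub _ (by
        rw [← sub_div]; simp)]
    congr 1
    field_simp
    ring
  have hsub : (hitsCells n K)ᶜ ⊆ ⋃ i : Fin K,
      Set.pi Set.univ fun _ : Fin n => (Set.Ioo ((i : ℝ) / K) ((i + 1) / K))ᶜ := by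
    intro S hS
    simp only [hitsCells, Set.mem_compl_iff, Set.mem_ofPred_eq, not_forall, not_exists] at hS
    obtain ⟨i, hi⟩ := hS
    exact Set.mem_iUnion.2 ⟨i, fun s _ => hi s⟩
  calc _ ≤ ∑ i : Fin K, uniformSample n
        (Set.pi Set.univ fun _ : Fin n => (Set.Ioo ((i : ℝ) / K) ((i + 1) / K))ᶜ) :=
        (measure_mono hsub).trans (measure_iUnion_fintype_le _ _)
    _ = _ := by
        simp_rw [uniformSample, Measure.pi_pi, hcell]
        rw [Finset.prod_const, Finset.sum_const, Finset.card_univ, Fintype.card_fin,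
          Finset.card_univ, Fintype.card_fin, nsmul_eq_mul, ENNReal.ofReal_mul hK'.le,
          ENNReal.ofReal_natCast, ENNReal.ofReal_pow h0]

lemma half_le_uniformSample_hitsCells {n K : ℕ} (hK : 0 < K)
    (h : (K : ℝ) * (1 - 1 / K) ^ n ≤ 1 / 2) :
    ENNReal.ofReal (1 / 2) ≤ uniformSample n (hitsCells n K) := by
  have h1 := (uniformSample_compl_hitsCells_le n K hK).trans (ENNReal.ofReal_le_ofReal h)
  have h2 := prob_add_prob_compl (μ := uniformSample n) (measurableSet_hitsCells n K)
  have h3 : ENNReal.ofReal (1 / 2) + ENNReal.ofReal (1 / 2) ≤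
      uniformSample n (hitsCells n K) + ENNReal.ofReal (1 / 2) := by
    rw [← ENNReal.ofReal_add (by norm_num) (by norm_num), add_halves, ENNReal.ofReal_one, ← h2]
    gcongr
  exact (ENNReal.add_le_add_iff_right ENNReal.ofReal_ne_top).1 h3

/-! ### Choice of parameters -/

/-- The number of cells used for a sample of size `n`. -/
noncomputable def cellCount (n : ℕ) : ℕ := ⌈(n : ℝ) ^ (3 / 4 : ℝ)⌉₊

lemma eventually_cellCount :
    ∀ᶠ n : ℕ in Filter.atTop, (cellCount n : ℝ) * (1 - 1 / cellCount n) ^ n ≤ 1 / 2 := by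
  -- With `u = n ^ (1/4)` there are at most `2 * u ^ 3` cells, so the quantity is at most `2 * u ^ 3
  -- * exp (-u / 2)`; the substitution `v = u / 2` produces the `16`.
  have h1 : Filter.Tendsto (fun v : ℝ => 16 * (v ^ 3 * Real.exp (-v))) Filter.atTop
      (nhds (16 * 0)) := (Real.tendsto_pow_mul_exp_neg_atTop_nhds_zero 3).const_mul 16
  have h2 : Filter.Tendsto (fun n : ℕ => (n : ℝ) ^ (1 / 4 : ℝ) / 2) Filter.atTop Filter.atTop :=
    ((tendsto_rpow_atTop (by norm_num)).comp tendsto_natCast_atTop_atTop).atTop_div_const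
      (by norm_num)
  have h3 := (h1.comp h2).eventually (ge_mem_nhds (show (16 : ℝ) * 0 < 1 / 2 by norm_num))
  filter_upwards [h3, Filter.eventually_ge_atTop 1] with n hn hn1
  refine le_trans ?_ hn
  have hn0 : (1 : ℝ) ≤ n := by exact_mod_cast hn1
  have hx : (0 : ℝ) < n := by linarith
  set u := (n : ℝ) ^ (1 / 4 : ℝ) with hu
  have hu1 : 1 ≤ u := Real.one_le_rpow hn0 (by norm_num)
  have hu3 : (n : ℝ) ^ (3 / 4 : ℝ) = u ^ 3 := by
    rw [hu, ← Real.rpow_natCast, ← Real.rpow_mul hx.le]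
    norm_num
  have hu4 : (n : ℝ) = u ^ 4 := by
    rw [hu, ← Real.rpow_natCast, ← Real.rpow_mul hx.le]
    norm_num
  have hK1 : (1 : ℝ) ≤ cellCount n := by
    have := Nat.le_ceil ((n : ℝ) ^ (3 / 4 : ℝ))
    rw [hu3] at this
    exact (one_le_pow₀ hu1).trans (by rw [cellCount, hu3]; exact this)
  have hK2 : (cellCount n : ℝ) ≤ 2 * u ^ 3 := by
    have := Nat.ceil_lt_add_one (show 0 ≤ (n : ℝ) ^ (3 / 4 : ℝ) by positivity)
    have h1 : 1 ≤ u ^ 3 := one_le_pow₀ hu1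
    rw [cellCount]
    rw [hu3] at this ⊢
    linarith
  set K : ℝ := (cellCount n : ℝ)
  have h0 : 0 ≤ 1 - 1 / K := sub_nonneg.2 ((div_le_one (by linarith)).2 hK1)
  have hpow : (1 - 1 / K) ^ n ≤ Real.exp (-(u / 2)) := by
    calc (1 - 1 / K) ^ n ≤ Real.exp (-(1 / K)) ^ n := by
          gcongr
          have := Real.add_one_le_exp (-(1 / K))
          linarith
      _ = Real.exp (-(n / K)) := by rw [← Real.exp_nat_mul]; ring_nf
      _ ≤ _ := by
          refine Real.exp_le_exp.2 (neg_le_neg ?_)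
          rw [hu4, div_le_div_iff₀ (by norm_num) (by linarith)]
          nlinarith [mul_le_mul_of_nonneg_left hK2 (show 0 ≤ u by linarith)]
  simp only [Function.comp_apply]
  calc K * (1 - 1 / K) ^ n ≤ (2 * u ^ 3) * Real.exp (-(u / 2)) := by gcongr
    _ = _ := by ring

lemma cellCount_pos {n : ℕ} (hn : 1 ≤ n) : 0 < cellCount n :=
  Nat.ceil_pos.2 (Real.rpow_pos_of_pos (by exact_mod_cast hn) _)

lemma gap_ratio_le {d n : ℕ} (hd : 1 ≤ d) (hn : (d : ℝ) ^ 2 ≤ n) :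
    2 * (2 / (cellCount n : ℝ)) / (1 / (2 * ((d : ℝ) + 1))) ≤ 16 * (n : ℝ) ^ (-(1 / 4) : ℝ) := by
  have hd1 : (1 : ℝ) ≤ d := by exact_mod_cast hd
  have hn1 : (1 : ℝ) ≤ n := le_trans (one_le_pow₀ hd1) hn
  have hx : (0 : ℝ) < n := by linarith
  have hK : (n : ℝ) ^ (3 / 4 : ℝ) ≤ cellCount n := Nat.le_ceil _
  have hd2 : (d : ℝ) ≤ (n : ℝ) ^ (1 / 2 : ℝ) := by
    rw [← Real.sqrt_eq_rpow]
    exact Real.le_sqrt_of_sq_le hn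
  have hpos : 0 < (n : ℝ) ^ (3 / 4 : ℝ) := by positivity
  calc 2 * (2 / (cellCount n : ℝ)) / (1 / (2 * ((d : ℝ) + 1)))
      = 8 * (d + 1) / cellCount n := by field_simp; norm_num
    _ ≤ 16 * (n : ℝ) ^ (1 / 2 : ℝ) / (n : ℝ) ^ (3 / 4 : ℝ) := by
        exact div_le_div₀ (by positivity) (by linarith) hpos hK
    _ = _ := by
        rw [mul_div_assoc, ← Real.rpow_sub hx]
        norm_num

/-- From `2 ≤ e`, the first factor is at most `e * n ^ (θ * d)` and the second at most `n ^ (-2 * θ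
* d)`. What remains, `e * n ^ (-θ)` at worst, is small for large `n` uniformly in `d ≥ 1`. -/
lemma two_pow_mul_pow_le {c θ : ℝ} (hc : 0 < c) (hθ : 0 < θ) {d n k : ℕ} (hd : 1 ≤ d)
    (hn : 1 ≤ n) {D η : ℝ} (hD0 : 0 ≤ D) (hD : D ≤ (n : ℝ) ^ (-η)) (hk : 2 * θ * d ≤ η * k)
    (hlarge : 4 * Real.exp 1 / c ≤ (n : ℝ) ^ θ) :
    2 ^ ⌈θ * d * Real.log n⌉₊ * D ^ k ≤ c / 4 := by
  have hd1 : (1 : ℝ) ≤ d := by exact_mod_cast hd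
  have hn1 : (1 : ℝ) ≤ n := by exact_mod_cast hn
  have hx : (0 : ℝ) < n := by linarith
  have hlog : 0 ≤ Real.log n := Real.log_nonneg hn1
  have h1 : (2 : ℝ) ^ ⌈θ * d * Real.log n⌉₊ ≤ Real.exp 1 * (n : ℝ) ^ (θ * d) := by
    have hceil := (Nat.ceil_lt_add_one (show 0 ≤ θ * d * Real.log n by positivity)).le
    calc (2 : ℝ) ^ ⌈θ * d * Real.log n⌉₊ ≤ Real.exp 1 ^ ⌈θ * d * Real.log n⌉₊ := by
          gcongr
          have := Real.add_one_le_exp 1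
          linarith
      _ = Real.exp ⌈θ * d * Real.log n⌉₊ := by rw [← Real.exp_nat_mul, mul_one]
      _ ≤ Real.exp (θ * d * Real.log n + 1) := by gcongr
      _ = _ := by
          rw [Real.exp_add, Real.rpow_def_of_pos hx, mul_comm]
          ring_nf
  have h2 : D ^ k ≤ (n : ℝ) ^ (-(2 * θ * d)) := by
    calc D ^ k ≤ ((n : ℝ) ^ (-η)) ^ k := by gcongr
      _ = (n : ℝ) ^ (-(η * k)) := by rw [← Real.rpow_mul_natCast hx.le]; ring_nf
      _ ≤ _ := Real.rpow_le_rpow_of_exponent_le hn1 (by linarith)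
  calc (2 : ℝ) ^ ⌈θ * d * Real.log n⌉₊ * D ^ k
      ≤ Real.exp 1 * (n : ℝ) ^ (θ * d) * (n : ℝ) ^ (-(2 * θ * d)) := by gcongr
    _ = Real.exp 1 * (n : ℝ) ^ (-(θ * d)) := by
        rw [mul_assoc, ← Real.rpow_add hx]
        ring_nf
    _ ≤ Real.exp 1 * (n : ℝ) ^ (-θ) := by
        gcongr
        nlinarith
    _ ≤ c / 4 := by
        rw [Real.rpow_neg hx.le, ← div_eq_mul_inv, div_le_iff₀ (by positivity)]
        rw [div_le_iff₀ hc] at hlarge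
        linarith

end PTFLearning

/-! ### Assembly -/

theorem mainTheorem8 (α : ℝ) (hα : 0 < α) :
    ∃ c C : ℝ, 0 < c ∧ 0 < C ∧
      ∀ d n : ℕ, 1 ≤ d → C * (d : ℝ) ^ 2 ≤ (n : ℝ) →
        ∀ (P : Measure (ℝ × (Fin (d + 1) → ℝ))), IsProbabilityMeasure P →
          PTFLearning.IsDirichletRootLaw d α P →
        ∀ (Ω : Type*) [MeasurableSpace Ω] (ρ : Measure Ω), IsProbabilityMeasure ρ →
        ∀ A : PTFLearning.Learner n d Ω, A.IsPerfect ρ →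
          ENNReal.ofReal (c * (d : ℝ) * Real.log (n : ℝ)) ≤ A.expectedQueries ρ P := by
  obtain ⟨K, η, hK, hη, hone⟩ := PTFLearning.exists_oneRootBound hα
  set c : ℝ := α / (4 * (α + 1)) with hc
  have hc0 : 0 < c := by positivity
  -- The value that makes `hkd` hold, given `k ≥ c * m / 2` and `d ≤ 2 * m` for `m` even indices.
  set θ : ℝ := η * c / 64 with hθ
  have hθ0 : 0 < θ := by positivity
  have hev1 : ∀ᶠ n : ℕ in Filter.atTop, 4 * Real.exp 1 / c ≤ (n : ℝ) ^ θ :=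
    ((tendsto_rpow_atTop hθ0).comp tendsto_natCast_atTop_atTop).eventually_ge_atTop _
  have hev2 : ∀ᶠ n : ℕ in Filter.atTop, K * 16 ^ η ≤ (n : ℝ) ^ (η / 8) :=
    ((tendsto_rpow_atTop (by positivity)).comp tendsto_natCast_atTop_atTop).eventually_ge_atTop _
  obtain ⟨N, hN⟩ := Filter.eventually_atTop.1
    (hev1.and (hev2.and PTFLearning.eventually_cellCount))
  -- The factor `c / 8` is `c / 4` from the bad roots times `1 / 2` from the good samples. In the
  -- maximum, `1` yields `d ^ 2 ≤ n` and `N` yields `N ≤ n`.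
  refine ⟨θ * c / 8, max 1 N, by positivity, by positivity, ?_⟩
  intro d n hd hn P _ hP Ω _ ρ _ A hA
  have hd1 : (1 : ℝ) ≤ d := by exact_mod_cast hd
  have hdn : (d : ℝ) ^ 2 ≤ n :=
    le_trans (le_mul_of_one_le_left (by positivity) (le_max_left _ _)) hn
  have hn1' : (1 : ℝ) ≤ n := (one_le_pow₀ hd1).trans hdn
  have hn1 : 1 ≤ n := by exact_mod_cast hn1'
  have hNn : N ≤ n := by
    have : (N : ℝ) ≤ n := by
      refine le_trans ?_ hn
      exact (le_max_right 1 (N : ℝ)).trans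
        (le_mul_of_one_le_right (by positivity) (one_le_pow₀ hd1))
    exact_mod_cast this
  obtain ⟨hlarge, hKn, hcells⟩ := hN n hNn
  have hcell := PTFLearning.cellCount_pos hn1
  set g : ℝ := 2 / (PTFLearning.cellCount n : ℝ) with hg
  have hg0 : 0 ≤ g := by positivity
  set D : ℝ := K * (2 * g / (1 / (2 * ((d : ℝ) + 1)))) ^ η with hDdef
  have hD0 : 0 ≤ D := by positivity
  have hx : (0 : ℝ) < n := by linarith
  have hD : D ≤ (n : ℝ) ^ (-(η / 8)) := by
    calc D ≤ K * (16 * (n : ℝ) ^ (-(1 / 4) : ℝ)) ^ η := by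
          have := PTFLearning.gap_ratio_le hd hdn
          rw [hDdef]
          gcongr
      _ = K * 16 ^ η * (n : ℝ) ^ (-(η / 4)) := by
          rw [Real.mul_rpow (by norm_num) (by positivity), ← Real.rpow_mul hx.le, mul_assoc]
          ring_nf
      -- Half of the decay is spent on absorbing the constant `K * 16 ^ η`.
      _ ≤ (n : ℝ) ^ (η / 8) * (n : ℝ) ^ (-(η / 4)) := by gcongr
      _ = _ := by
          rw [← Real.rpow_add hx]
          ring_nf
  have hD1 : D ≤ 1 := hD.trans (Real.rpow_le_one_of_one_le_of_nonpos hn1' (by linarith))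
  set k : ℕ := ⌈c / 2 * (PTFLearning.evenIndices d).card⌉₊ with hk
  set q : ℕ := ⌈θ * d * Real.log n⌉₊ with hq
  have hkd : 2 * θ * d ≤ η / 8 * k := by
    have h1 : c / 2 * (PTFLearning.evenIndices d).card ≤ k := Nat.le_ceil _
    have h2 : (d : ℝ) ≤ 2 * (PTFLearning.evenIndices d).card := by
      exact_mod_cast PTFLearning.card_evenIndices d
    calc 2 * θ * d ≤ 2 * θ * (2 * (PTFLearning.evenIndices d).card) := by gcongr
      _ = η / 8 * (c / 2 * (PTFLearning.evenIndices d).card) := by rw [hθ]; ring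
      _ ≤ _ := by gcongr
  have hbound := PTFLearning.two_pow_mul_pow_le hc0 hθ0 hd hn1 hD0 hD hkd hlarge
  have hbound' : 2 ^ q * ENNReal.ofReal D ^ k ≤ ENNReal.ofReal (c / 4) := by
    rw [← ENNReal.ofReal_pow hD0, show (2 : ℝ≥0∞) = ENNReal.ofReal 2 by simp,
      ← ENNReal.ofReal_pow (by norm_num), ← ENNReal.ofReal_mul (by positivity)]
    exact ENNReal.ofReal_le_ofReal hbound
  have hsample : ∀ S : Fin n → ℝ, Function.Injective S →
      S ∈ PTFLearning.hitsCells n (PTFLearning.cellCount n) →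
      ENNReal.ofReal (q * (c / 4)) ≤ ∫⁻ ω, ∫⁻ p, ((A S ω).numQueries S
        (PTFLearning.polyOfSpacings p.1 p.2) : ℝ≥0∞) ∂P ∂ρ := by
    intro S hinj hS
    calc ENNReal.ofReal (q * (c / 4)) = ∫⁻ _, ENNReal.ofReal (q * (c / 4)) ∂ρ := by simp
      _ ≤ _ := by
        refine lintegral_mono_ae ?_
        filter_upwards [hA.ae_forall hinj] with ω hω
        exact PTFLearning.le_lintegral_numQueries hα hd hg0
          (PTFLearning.gapBound_of_mem_hitsCells hcell hS)
          (hone g _ hg0 (by positivity)) (ENNReal.ofReal_le_one.2 hD1) hP (A S ω) hω q hbound'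
  calc ENNReal.ofReal (θ * c / 8 * d * Real.log n)
      ≤ ENNReal.ofReal (q * (c / 4) * (1 / 2)) := by
        refine ENNReal.ofReal_le_ofReal ?_
        have := Nat.le_ceil (θ * d * Real.log n)
        rw [← hq] at this
        nlinarith
    _ ≤ ENNReal.ofReal (q * (c / 4)) * PTFLearning.uniformSample n
        (PTFLearning.hitsCells n (PTFLearning.cellCount n)) := by
        rw [ENNReal.ofReal_mul (by positivity)]
        gcongr
        exact PTFLearning.half_le_uniformSample_hitsCells hcell hcells
    _ = ∫⁻ S, (PTFLearning.hitsCells n (PTFLearning.cellCount n)).indicator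
          (fun _ => ENNReal.ofReal (q * (c / 4))) S ∂(PTFLearning.uniformSample n) :=
        (lintegral_indicator_const (PTFLearning.measurableSet_hitsCells n _) _).symm
    _ ≤ A.expectedQueries ρ P := by
        refine lintegral_mono_ae ?_
        filter_upwards [PTFLearning.ae_uniformSample_injective n] with S hinj
        by_cases hS : S ∈ PTFLearning.hitsCells n (PTFLearning.cellCount n)
        · rw [Set.indicator_of_mem hS]
          exact hsample S hinj hS
        · rw [Set.indicator_of_notMem hS]
          exact zero_le
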